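/- A coarse structure on a set $X$ is a collection of subsets of $X\times X$ (entourages) that contains the diagonal and is closed under subsets, finite unions, inverses and compositions. It is connected if every point of $X\times X$ lies in an entourage. For an entourage $L$ put $L(x)=\{y\mid (y,x)\in L\}$; sets of the form $L(x)$ are called bounded. A map is coarsely uniform if $f\times f$ maps entourages to entourages. For a coarse space $X$ and $n\in\mathbb N=\{0,1,2,\dots\}$, $\operatorname{asdim}X\le n$ means that for every entourage $L$ there is a cover $\mathcal U$ of $X$ such that every point lies in at most $n+1$ members of $\mathcal U$, every $L(x)$ is contained in some member of $\mathcal U$, and $\bigcup_{U\in\mathcal U}U\times U$ is an entourage; $\operatorname{asdim}X\in\mathbb N\cup\{\infty\}$ is the least such $n$, or $\infty$ if there is none. A ray is $R=(\mathbb R_+,\mathcal E)$, with $\mathbb R_+=[0,\infty)$, where $\mathcal E$ is a connected coarse structure such that some neighbourhood of the diagonal is an entourage, the closure of every bounded set is compact, and for all entourages $M,N$ also $$\{(u+x,v+y)\mid (u,v)\in M,\ (x,y)\in N\}$$ and $$\{(u,v)\mid \exists (x,y)\in M:\ x\le u\le v\le y\ \text{ or }\ y\le v\le u\le x\}$$ are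 entourages. For a ray $R$ and $n\in\mathbb N$ let $$D^nR=(R\sqcup R)^n\times R,\qquad S^{n-1}R=(R\sqcup R)^n\times\{0\}\subseteq D^nR .$$ Here $D^nR$ carries the product coarse structure (a relation is an entourage iff all its projections to the factors are), $S^{n-1}R$ the restricted one, and $R\sqcup R$ carries (the same choice for all cells) either the coproduct coarse structure, i.e. the smallest one for which both inclusions of $R$ are coarsely uniform, or the connected coarse structure generated by it. A coarse cell complex $Y$ is built from sets $I_k$ ($k\in\mathbb N$) and, for all $k\in\mathbb N$ and $i\in I_k$, numbers $n_{k,i}\in\mathbb N$, rays $R_{k,i}$ and, if $k\ge1$, coarsely uniform maps $f_{k,i}\colon S^{n_{k,i}-1}R_{k,i}\to Y_{k-1}$, where $$Y_0=\coprod_{i\in I_0}D^{n_{0,i}}R_{0,i},\qquad Y_k=\Bigl(\coprod_{i\in I_k}D^{n_{k,i}}R_{k,i}\Bigr)\cup_{f_k}Y_{k-1}\quad(k\ge 1),\qquad f_k=\coprod_{i\in I_k} f_{k,i},$$ and $Y=\varinjlim Y_k$. Coproducts and the direct limit carry the smallest coarse structure for which all canonical maps into them are coarsely uniform, and $X\cup_f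 Z$, the quotient of $X\sqcup Z$ by the equivalence relation generated by $a\sim f(a)$, carries the coarse structure generated by the images of the entourages of $X\sqcup Z$. The cell dimension of $Y$ is $\delta(Y)=\sup\{n_{k,i}\mid k\in\mathbb N,\ i\in I_k\}\in\mathbb N\cup\{\infty\}$. Theorem. For every non-empty coarse cell complex $Y$, and for each of the two choices of the coarse structure on $R\sqcup R$, $$\operatorname{asdim}Y=\delta(Y)+1 .$$ -/

import Mathlib

open scoped NNReal

universe u v

/-- A coarse structure on `X`: a collection of relations (the entourages) that contains the diagonal
and is closed under subsets, finite unions, inverses and composition. -/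
@[ext]
structure CoarseStructure (X : Type*) where
  entourages : Set (SetRel X X)
  subset_mem : ∀ {M N : SetRel X X}, N ∈ entourages → M ⊆ N → M ∈ entourages
  union_mem : ∀ {M N : SetRel X X}, M ∈ entourages → N ∈ entourages → M ∪ N ∈ entourages
  diag_mem : SetRel.id ∈ entourages
  inv_mem : ∀ {M : SetRel X X}, M ∈ entourages → M.inv ∈ entourages
  comp_mem : ∀ {M N : SetRel X X}, M ∈ entourages → N ∈ entourages → M.comp N ∈ entourages

namespace CoarseStructure

variable {X Y : Type*}

/-- The image of a relation under `f × f`. -/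
def mapRel (f : X → Y) (M : SetRel X X) : SetRel Y Y := Prod.map f f '' M

/-- `L(x) = {y | (y, x) ∈ L}`. -/
def slice (L : SetRel X X) (x : X) : Set X := {y | (y, x) ∈ L}

/-- Every point of `X × X` is contained in an entourage. -/
def IsConnected (E : CoarseStructure X) : Prop := ∀ p : X × X, ∃ M ∈ E.entourages, p ∈ M

/-- Bounded sets are the sets of the form `M(x)` with `M` an entourage. -/
def IsBounded (E : CoarseStructure X) (B : Set X) : Prop :=
  ∃ M ∈ E.entourages, ∃ x : X, B = slice M x

/-- The image under `f × f` of every entourage is an entourage. -/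
def CoarselyUniform (E : CoarseStructure X) (F : CoarseStructure Y) (f : X → Y) : Prop :=
  ∀ M ∈ E.entourages, mapRel f M ∈ F.entourages

/-- Compatibility of a coarse structure with the topology: some neighbourhood of the diagonal is an
entourage, and bounded sets have compact closure. -/
structure IsCompatible [TopologicalSpace X] (E : CoarseStructure X) : Prop where
  nhds_diag : ∃ N ∈ E.entourages, N ∈ nhdsSet (Set.diagonal X)
  compact_closure : ∀ B : Set X, E.IsBounded B → IsCompact (closure B)

/-- The smallest coarse structure containing `S`. -/
def generate (S : Set (SetRel X X)) : CoarseStructure X where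
  entourages := {M | ∀ C : CoarseStructure X, S ⊆ C.entourages → M ∈ C.entourages}
  subset_mem hN h C hC := C.subset_mem (hN C hC) h
  union_mem hM hN C hC := C.union_mem (hM C hC) (hN C hC)
  diag_mem C _ := C.diag_mem
  inv_mem hM C hC := C.inv_mem (hM C hC)
  comp_mem hM hN C hC := C.comp_mem (hM C hC) (hN C hC)

/-- The smallest connected coarse structure containing `S`. -/
def generateConnected (S : Set (SetRel X X)) : CoarseStructure X where
  entourages :=
    {M | ∀ C : CoarseStructure X, C.IsConnected → S ⊆ C.entourages → M ∈ C.entourages}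
  subset_mem hN h C h' hC := C.subset_mem (hN C h' hC) h
  union_mem hM hN C h' hC := C.union_mem (hM C h' hC) (hN C h' hC)
  diag_mem C _ _ := C.diag_mem
  inv_mem hM C h' hC := C.inv_mem (hM C h' hC)
  comp_mem hM hN C h' hC := C.comp_mem (hM C h' hC) (hN C h' hC)

/-- The pull-back of a coarse structure along a map: `M` is an entourage iff its image is. -/
def comap (f : X → Y) (F : CoarseStructure Y) : CoarseStructure X where
  entourages := {M | mapRel f M ∈ F.entourages}
  subset_mem hN h := F.subset_mem hN (Set.image_mono h)
  union_mem {M N} hM hN := by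
    have h := F.union_mem hM hN
    simpa only [Set.mem_ofPred_eq, mapRel, Set.image_union] using h
  diag_mem := by
    refine F.subset_mem F.diag_mem ?_
    rintro _ ⟨⟨a, b⟩, h, rfl⟩
    change a = b at h
    change f a = f b
    rw [h]
  inv_mem {M} hM := by
    refine F.subset_mem (F.inv_mem hM) ?_
    rintro _ ⟨⟨a, b⟩, h, rfl⟩
    exact ⟨(b, a), h, rfl⟩
  comp_mem {M N} hM hN := by
    refine F.subset_mem (F.comp_mem hM hN) ?_
    rintro _ ⟨⟨a, c⟩, ⟨b, hab, hbc⟩, rfl⟩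
    exact ⟨f b, ⟨(a, b), hab, rfl⟩, ⟨(b, c), hbc, rfl⟩⟩

/-- The restriction of a coarse structure to a subset. -/
def restrict (E : CoarseStructure X) (A : Set X) : CoarseStructure A :=
  E.comap Subtype.val

/-- The coarse structure generated by the images of the entourages under a family of maps, i.e. the
smallest coarse structure for which all these maps are coarsely uniform. -/
def final {J : Type*} {Z : J → Type*} (E : ∀ j, CoarseStructure (Z j)) (f : ∀ j, Z j → Y) :
    CoarseStructure Y :=
  generate {N | ∃ j, ∃ M ∈ (E j).entourages, N = mapRel (f j) M}

/-- The coproduct coarse structure of a family of coarse spaces. -/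
def coprod {J : Type*} {Z : J → Type*} (E : ∀ j, CoarseStructure (Z j)) :
    CoarseStructure (Σ j, Z j) :=
  final E fun j z => ⟨j, z⟩

/-- The coproduct (equivalently, the disjoint union) of two coarse structures. -/
def sum (E : CoarseStructure X) (F : CoarseStructure Y) : CoarseStructure (X ⊕ Y) :=
  generate (mapRel Sum.inl '' E.entourages ∪ mapRel Sum.inr '' F.entourages)

/-- The product coarse structure of a family: a relation is an entourage iff all its projections
are. -/
def pi {J : Type*} {Z : J → Type*} (E : ∀ j, CoarseStructure (Z j)) :
    CoarseStructure (∀ j, Z j) where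
  entourages := {M | ∀ j, M ∈ ((E j).comap fun x : ∀ j, Z j => x j).entourages}
  subset_mem hN h j := CoarseStructure.subset_mem _ (hN j) h
  union_mem hM hN j := CoarseStructure.union_mem _ (hM j) (hN j)
  diag_mem _ := CoarseStructure.diag_mem _
  inv_mem hM j := CoarseStructure.inv_mem _ (hM j)
  comp_mem hM hN j := CoarseStructure.comp_mem _ (hM j) (hN j)

/-- The product coarse structure of two coarse structures. -/
def prod (E : CoarseStructure X) (F : CoarseStructure Y) : CoarseStructure (X × Y) where
  entourages := (E.comap Prod.fst).entourages ∩ (F.comap Prod.snd).entourages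
  subset_mem hN h := ⟨CoarseStructure.subset_mem _ hN.1 h, CoarseStructure.subset_mem _ hN.2 h⟩
  union_mem hM hN :=
    ⟨CoarseStructure.union_mem _ hM.1 hN.1, CoarseStructure.union_mem _ hM.2 hN.2⟩
  diag_mem := ⟨CoarseStructure.diag_mem _, CoarseStructure.diag_mem _⟩
  inv_mem hM := ⟨CoarseStructure.inv_mem _ hM.1, CoarseStructure.inv_mem _ hM.2⟩
  comp_mem hM hN :=
    ⟨CoarseStructure.comp_mem _ hM.1 hN.1, CoarseStructure.comp_mem _ hM.2 hN.2⟩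

/-- The relation on `X ⊔ Y` that identifies `a ∈ A` with `f a`. -/
inductive AttachRel {A : Set X} (f : A → Y) : X ⊕ Y → X ⊕ Y → Prop
  | glue (a : A) : AttachRel f (Sum.inl a) (Sum.inr (f a))

/-- The set `X ∪_f Y` obtained by attaching `X` to `Y` along `f : A → Y`, where `A ⊆ X`: the quotient
of `X ⊔ Y` by the equivalence relation generated by `a ∼ f a`. -/
def Attach {A : Set X} (f : A → Y) : Type _ := Quot (AttachRel f)

/-- The coarse structure of `X ∪_f Y`, generated by the images of the entourages of `X ⊔ Y`. -/
def attach (E : CoarseStructure X) (F : CoarseStructure Y) {A : Set X} (f : A → Y) :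
    CoarseStructure (Attach f) :=
  generate (mapRel (Quot.mk (AttachRel f)) '' (E.sum F).entourages)

/-- `asdim X ≤ n`: for every entourage `L` there is a uniformly bounded cover with appetite `L` and
multiplicity at most `n + 1`. -/
def AsdimLE (E : CoarseStructure X) (n : ℕ) : Prop :=
  ∀ L ∈ E.entourages, ∃ U : Set (Set X),
    ⋃₀ U = Set.univ ∧
    (∀ x : X, {V ∈ U | x ∈ V}.encard ≤ n + 1) ∧
    (∀ x : X, ∃ V ∈ U, slice L x ⊆ V) ∧
    (⋃ V ∈ U, V ×ˢ V) ∈ E.entourages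

/-- The asymptotic dimension: the least `n` with `asdim ≤ n`, or `∞` if there is none. -/
noncomputable def asdim (E : CoarseStructure X) : ℕ∞ := ⨅ (n : ℕ) (_ : E.AsdimLE n), (n : ℕ∞)

/-- The coarse space `(ℝ₊, E)` is a ray. -/
structure IsRay (E : CoarseStructure ℝ≥0) : Prop where
  connected : E.IsConnected
  compatible : E.IsCompatible
  add_mem : ∀ M ∈ E.entourages, ∀ N ∈ E.entourages,
    {p : ℝ≥0 × ℝ≥0 | ∃ a ∈ M, ∃ b ∈ N, p = (a.1 + b.1, a.2 + b.2)} ∈ E.entourages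
  between_mem : ∀ M ∈ E.entourages,
    {p : ℝ≥0 × ℝ≥0 | ∃ q ∈ M, (q.1 ≤ p.1 ∧ p.1 ≤ p.2 ∧ p.2 ≤ q.2) ∨
      (q.2 ≤ p.2 ∧ p.2 ≤ p.1 ∧ p.1 ≤ q.1)} ∈ E.entourages

end CoarseStructure

open CoarseStructure

/-- The two choices of a coarse structure on `R ⊔ R`. -/
inductive DoubleKind
  | coproduct
  | connected

/-- The coarse structure on `R ⊔ R`: the coproduct coarse structure, or the connected coarse
structure generated by it. -/
def doubleRay : DoubleKind → CoarseStructure ℝ≥0 → CoarseStructure (ℝ≥0 ⊕ ℝ≥0)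
  | .coproduct, R => R.sum R
  | .connected, R => generateConnected (R.sum R).entourages

/-- The underlying set of the coarse cell `DⁿR = (R ⊔ R)ⁿ × R`. -/
abbrev Cell (n : ℕ) : Type := (Fin n → ℝ≥0 ⊕ ℝ≥0) × ℝ≥0

/-- The product coarse structure on `DⁿR = (R ⊔ R)ⁿ × R`. -/
def cellStructure (κ : DoubleKind) (R : CoarseStructure ℝ≥0) (n : ℕ) : CoarseStructure (Cell n) :=
  (CoarseStructure.pi fun _ : Fin n => doubleRay κ R).prod R

/-- The coarse sphere `Sⁿ⁻¹R = (R ⊔ R)ⁿ × {0}` as a subset of the coarse cell `DⁿR`. -/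
def boundarySphere (n : ℕ) : Set (Cell n) := {x | x.2 = 0}

/-- The disjoint union of the spheres `S^{n i - 1}`, as a subset of the disjoint union of the cells
`D^{n i}`. -/
def allSpheres {J : Type*} (n : J → ℕ) : Set (Σ j, Cell (n j)) := {x | x.2 ∈ boundarySphere (n x.1)}

/-- The map on the disjoint union of the spheres induced by maps on the single spheres. -/
def jointMap {J Y : Type*} {n : J → ℕ} (f : ∀ j, boundarySphere (n j) → Y) : allSpheres n → Y :=
  fun x => f x.1.1 ⟨x.1.2, x.2⟩

/-- The data of a coarse cell complex. The stage `Y 0` is (isomorphic to) a coproduct of coarse cells,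
and `Y (k + 1)` is (isomorphic to) the space obtained from `Y k` by attaching the coproduct of the
cells `D^{n (k+1) i} R (k+1) i` along the coarsely uniform maps `f k i` on the spheres. -/
structure CoarseCellComplex (κ : DoubleKind) where
  /-- the stages, as sets -/
  Y : ℕ → Type u
  /-- the coarse structures of the stages -/
  E : ∀ k, CoarseStructure (Y k)
  /-- the index sets of the cells -/
  I : ℕ → Type v
  /-- the dimensions of the cells -/
  n : ∀ k, I k → ℕ
  /-- the rays from which the cells are built -/
  R : ∀ k, I k → CoarseStructure ℝ≥0
  isRay : ∀ k i, (R k i).IsRay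
  /-- the attaching maps -/
  f : ∀ k (i : I (k + 1)), boundarySphere (n (k + 1) i) → Y k
  f_uniform : ∀ k (i : I (k + 1)),
    CoarselyUniform ((cellStructure κ (R (k + 1) i) (n (k + 1) i)).restrict (boundarySphere _))
      (E k) (f k i)
  /-- the identification of `Y 0` with the coproduct of the cells -/
  zeroEquiv : Y 0 ≃ Σ i : I 0, Cell (n 0 i)
  zero_structure :
    E 0 = (coprod fun i => cellStructure κ (R 0 i) (n 0 i)).comap zeroEquiv
  /-- the identification of `Y (k + 1)` with the space obtained by attaching cells to `Y k` -/
  succEquiv : ∀ k, Y (k + 1) ≃ Attach (jointMap (f k))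
  succ_structure : ∀ k,
    E (k + 1) = ((coprod fun i => cellStructure κ (R (k + 1) i) (n (k + 1) i)).attach (E k)
      (jointMap (f k))).comap (succEquiv k)

namespace CoarseCellComplex

variable {κ : DoubleKind}

/-- The canonical map `Y k → Y (k + 1)`. -/
def incl (C : CoarseCellComplex.{u, v} κ) (k : ℕ) (y : C.Y k) : C.Y (k + 1) :=
  (C.succEquiv k).symm (Quot.mk _ (Sum.inr y))

/-- The relation that identifies a point of a stage with its image in the next stage. -/
inductive LimRel (C : CoarseCellComplex.{u, v} κ) : (Σ k, C.Y k) → (Σ k, C.Y k) → Prop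
  | step (k : ℕ) (y : C.Y k) : LimRel C ⟨k, y⟩ ⟨k + 1, C.incl k y⟩

/-- The underlying set of the coarse cell complex: the direct limit of the stages. -/
def Space (C : CoarseCellComplex.{u, v} κ) : Type u := Quot C.LimRel

/-- The canonical map from a stage to the direct limit. -/
def toSpace (C : CoarseCellComplex.{u, v} κ) (k : ℕ) (y : C.Y k) : C.Space := Quot.mk _ ⟨k, y⟩

/-- The coarse structure of the coarse cell complex: that of the direct limit of the stages. -/
def coarseStructure (C : CoarseCellComplex.{u, v} κ) : CoarseStructure C.Space :=
  final C.E C.toSpace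

/-- The cell dimension: the supremum of the dimensions of all the cells. -/
noncomputable def cellDim (C : CoarseCellComplex.{u, v} κ) : ℕ∞ :=
  ⨆ (k : ℕ) (i : C.I k), (C.n k i : ℕ∞)

end CoarseCellComplex

/-! ### Entourages, coarsely uniform maps, final structures -/

namespace CoarseStructure

variable {X Y Z : Type*}

/-! Upper bound. Asymptotic dimension is bounded through colourings (`ColoredLE`): n + 1 colours
with uniformly bounded monochromatic L-components give a cover of multiplicity n + 1. A cell of
dimension n is a product of n + 1 factors, each a ray or a doubled ray. A ray is cut into uniformly
bounded intervals such that L joins only equal or neighbouring ones, and these are coloured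
cyclically with n + 2 colours; then the L-chains that avoid any one colour are uniformly bounded
(`AvoidLE`), and doubled rays inherit this by folding. The n + 1 coordinates of a point use at most
n + 1 of these colours. Giving the point an unused one proves `cellStructure_coloredLE`.

Gluing costs no further colour, because (x, t) ↦ (x, 0) is a coarsely uniform retraction of a cell
onto its sphere, and hence each stage retracts onto the previous one. Far from the previous stage
entourages come from the cells; uniformly near it, points are close as soon as their retractions
are. A union argument (`exists_coloring_union`) merges the two colourings. The limit adds nothing:
off the diagonal, an entourage of the complex lies in the image of an entourage of a single stage
(`exists_of_mem`).

Lower bound. Crushing the boundary of one cell, and all that lies outside it in its stage, to a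
point gives a map from the complex to the cell. It is coarsely uniform once the regions of bounded
height are declared bounded (`collapse`). Given a cover with appetite for unit steps, one takes an
(n + 1)-dimensional grid above the collapsed region, so large that no member meets two opposite
faces. Kuhn's cubical form of Sperner's lemma yields n + 2 members through one point
(`AsdimLE.le_of_cell`). -/

theorem mem_mapRel {f : X → Y} {M : SetRel X X} {a b : Y} :
    (a, b) ∈ mapRel f M ↔ ∃ x y, (x, y) ∈ M ∧ f x = a ∧ f y = b := by
  simp [mapRel]

theorem mk_mem_mapRel (f : X → Y) {M : SetRel X X} {x y : X} (h : (x, y) ∈ M) :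
    (f x, f y) ∈ mapRel f M :=
  mem_mapRel.2 ⟨x, y, h, rfl, rfl⟩

theorem mapRel_subset {f : X → Y} {M : SetRel X X} {N : SetRel Y Y}
    (h : ∀ x y, (x, y) ∈ M → (f x, f y) ∈ N) : mapRel f M ⊆ N := by
  rintro _ ⟨⟨x, y⟩, hxy, rfl⟩
  exact h x y hxy

theorem mapRel_mono (f : X → Y) {M N : SetRel X X} (h : M ⊆ N) : mapRel f M ⊆ mapRel f N :=
  Set.image_mono h

theorem mapRel_mapRel (g : Y → Z) (f : X → Y) (M : SetRel X X) :
    mapRel g (mapRel f M) = mapRel (g ∘ f) M := by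
  simp only [mapRel, Set.image_image]
  rfl

theorem mapRel_id (M : SetRel X X) : mapRel id M = M := by
  simp [mapRel]

theorem mem_comap {f : X → Y} {F : CoarseStructure Y} {M : SetRel X X} :
    M ∈ (F.comap f).entourages ↔ mapRel f M ∈ F.entourages := Iff.rfl

namespace CoarselyUniform

variable {E : CoarseStructure X} {F : CoarseStructure Y} {G : CoarseStructure Z}

theorem comp {g : Y → Z} {f : X → Y} (hg : CoarselyUniform F G g) (hf : CoarselyUniform E F f) :
    CoarselyUniform E G (g ∘ f) := by
  intro M hM
  rw [← mapRel_mapRel]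
  exact hg _ (hf _ hM)

theorem comap (f : X → Y) (F : CoarseStructure Y) : CoarselyUniform (F.comap f) F f :=
  fun _ hM => hM

theorem refl (E : CoarseStructure X) : CoarselyUniform E E id := by
  intro M hM
  rwa [mapRel_id]

theorem const (y : Y) : CoarselyUniform E F fun _ => y :=
  fun _ _ => F.subset_mem F.diag_mem (mapRel_subset fun _ _ _ => rfl)

end CoarselyUniform

section Basic

variable (E : CoarseStructure X)

theorem empty_mem : (∅ : SetRel X X) ∈ E.entourages :=
  E.subset_mem E.diag_mem (Set.empty_subset _)

theorem biUnion_mem {J : Type*} (s : Finset J) {M : J → SetRel X X}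
    (h : ∀ j ∈ s, M j ∈ E.entourages) : (⋃ j ∈ s, M j) ∈ E.entourages := by
  classical
  induction s using Finset.induction_on with
  | empty => simpa using E.empty_mem
  | insert a s _ ih =>
    rw [Finset.set_biUnion_insert]
    exact E.union_mem (h a (by simp)) (ih fun j hj => h j (by simp [hj]))

variable {E}

/-- Every entourage is contained in a reflexive and symmetric one. -/
theorem exists_symm {M : SetRel X X} (hM : M ∈ E.entourages) :
    ∃ N ∈ E.entourages, M ⊆ N ∧ (∀ x, (x, x) ∈ N) ∧ ∀ x y, (x, y) ∈ N → (y, x) ∈ N := by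
  refine ⟨M ∪ M.inv ∪ SetRel.id, E.union_mem (E.union_mem hM (E.inv_mem hM)) E.diag_mem,
    fun p hp => Or.inl (Or.inl hp), fun x => Or.inr rfl, ?_⟩
  rintro x y ((h | h) | h)
  · exact Or.inl (Or.inr h)
  · exact Or.inl (Or.inl h)
  · exact Or.inr (Eq.symm h)

theorem generate_subset {S : Set (SetRel X X)} {C : CoarseStructure X} (h : S ⊆ C.entourages) :
    (generate S).entourages ⊆ C.entourages :=
  fun _ hM => hM C h

theorem mem_generate {S : Set (SetRel X X)} {M : SetRel X X} (h : M ∈ S) :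
    M ∈ (generate S).entourages :=
  fun _ hC => hC h

end Basic

section Final

variable {J : Type*} {W : J → Type*} {E : ∀ j, CoarseStructure (W j)} {f : ∀ j, W j → Y}

theorem coarselyUniform_to_final (j : J) : CoarselyUniform (E j) (final E f) (f j) :=
  fun M hM => mem_generate ⟨j, M, hM, rfl⟩

theorem final_subset {C : CoarseStructure Y} (h : ∀ j, CoarselyUniform (E j) C (f j)) :
    (final E f).entourages ⊆ C.entourages :=
  generate_subset <| by
    rintro _ ⟨j, M, hM, rfl⟩
    exact h j M hM

theorem coarselyUniform_from_final {F : CoarseStructure Z} {g : Y → Z}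
    (h : ∀ j, CoarselyUniform (E j) F (g ∘ f j)) : CoarselyUniform (final E f) F g :=
  final_subset (C := F.comap g) fun j M hM => by
    rw [mem_comap, mapRel_mapRel]
    exact h j M hM

end Final

section Sum

variable {E : CoarseStructure X} {F : CoarseStructure Y}

theorem coarselyUniform_inl : CoarselyUniform E (E.sum F) Sum.inl :=
  fun M hM => mem_generate (Or.inl ⟨M, hM, rfl⟩)

theorem coarselyUniform_inr : CoarselyUniform F (E.sum F) Sum.inr :=
  fun M hM => mem_generate (Or.inr ⟨M, hM, rfl⟩)

theorem sum_subset {C : CoarseStructure (X ⊕ Y)} (h : CoarselyUniform E C Sum.inl)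
    (h' : CoarselyUniform F C Sum.inr) : (E.sum F).entourages ⊆ C.entourages :=
  generate_subset <| by
    rintro _ (⟨M, hM, rfl⟩ | ⟨M, hM, rfl⟩)
    exacts [h M hM, h' M hM]

end Sum

/-! ### Coproducts -/

section Coprod

variable {J : Type*} {W : J → Type*}

theorem coarselyUniform_sigmaMk (E : ∀ j, CoarseStructure (W j)) (j : J) :
    CoarselyUniform (E j) (coprod E) (Sigma.mk j) :=
  coarselyUniform_to_final (f := fun j z => (⟨j, z⟩ : Σ j, W j)) j

theorem coarselyUniform_from_coprod {E : ∀ j, CoarseStructure (W j)} {F : CoarseStructure Y}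
    {g : (Σ j, W j) → Y} (h : ∀ j, CoarselyUniform (E j) F fun z => g ⟨j, z⟩) :
    CoarselyUniform (coprod E) F g :=
  coarselyUniform_from_final h

/-- The part of a relation on a disjoint union that lies in one of the summands. -/
def component (M : SetRel (Σ j, W j) (Σ j, W j)) (j : J) : SetRel (W j) (W j) :=
  {p | ((⟨j, p.1⟩ : Σ j, W j), (⟨j, p.2⟩ : Σ j, W j)) ∈ M}

/-- An explicit description of the coproduct coarse structure. -/
def coprodExplicit (E : ∀ j, CoarseStructure (W j)) : CoarseStructure (Σ j, W j) where
  -- Generation allows only finitely many operations, so only finitely many summands can carry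
  -- anything off the diagonal.
  entourages := {M | (∀ a b, (a, b) ∈ M → a.1 = b.1) ∧ (∀ j, component M j ∈ (E j).entourages) ∧
    {j | ¬ component M j ⊆ SetRel.id}.Finite}
  subset_mem {M N} hN h :=
    ⟨fun a b hab => hN.1 a b (h hab), fun j => (E j).subset_mem (hN.2.1 j) fun _ hp => h hp,
      hN.2.2.subset fun _ hj h' => hj fun _ hp => h' (h hp)⟩
  union_mem {M N} hM hN := by
    refine ⟨fun a b hab => hab.elim (hM.1 a b) (hN.1 a b),
      fun j => (E j).union_mem (hM.2.1 j) (hN.2.1 j), (hM.2.2.union hN.2.2).subset ?_⟩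
    intro j hj
    by_contra h
    simp only [Set.mem_union, Set.mem_ofPred_eq, not_or, not_not] at h
    exact hj fun p hp => hp.elim (fun hp => h.1 hp) (fun hp => h.2 hp)
  diag_mem := by
    refine ⟨fun a b hab => congrArg Sigma.fst hab, fun j => ?_, ?_⟩
    · refine (E j).subset_mem (E j).diag_mem ?_
      rintro ⟨a, b⟩ h
      exact eq_of_heq (Sigma.mk.inj h).2
    · convert Set.finite_empty
      ext j
      simp only [Set.mem_ofPred_eq, Set.mem_empty_iff_false, iff_false, not_not]
      rintro ⟨a, b⟩ h
      exact eq_of_heq (Sigma.mk.inj h).2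
  inv_mem {M} hM := by
    refine ⟨fun a b hab => (hM.1 b a hab).symm, fun j => (E j).inv_mem (hM.2.1 j),
      hM.2.2.subset fun j hj h => hj ?_⟩
    rintro ⟨a, b⟩ hab
    exact Eq.symm (h (a := (b, a)) hab)
  comp_mem {M N} hM hN := by
    have key : ∀ j, component (M.comp N) j ⊆ (component M j).comp (component N j) := by
      rintro j ⟨a, c⟩ ⟨⟨j', b⟩, hab, hbc⟩
      obtain rfl : j = j' := hM.1 _ _ hab
      exact ⟨b, hab, hbc⟩
    refine ⟨?_, fun j => (E j).subset_mem ((E j).comp_mem (hM.2.1 j) (hN.2.1 j)) (key j),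
      (hM.2.2.union hN.2.2).subset ?_⟩
    · rintro a c ⟨b, hab, hbc⟩
      exact (hM.1 _ _ hab).trans (hN.1 _ _ hbc)
    · intro j hj
      by_contra h
      simp only [Set.mem_union, Set.mem_ofPred_eq, not_or, not_not] at h
      refine hj fun p hp => ?_
      obtain ⟨b, hab, hbc⟩ := key j hp
      exact (h.1 hab : p.1 = b).trans (h.2 hbc)

theorem mem_coprod_iff {E : ∀ j, CoarseStructure (W j)} {M : SetRel (Σ j, W j) (Σ j, W j)} :
    M ∈ (coprod E).entourages ↔ (∀ a b, (a, b) ∈ M → a.1 = b.1) ∧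
      (∀ j, component M j ∈ (E j).entourages) ∧ {j | ¬ component M j ⊆ SetRel.id}.Finite := by
  constructor
  · intro h
    refine final_subset (C := coprodExplicit E) (fun j N hN => ⟨?_, ?_, ?_⟩) h
    · rintro _ _ ⟨_, _, h⟩
      cases h
      rfl
    · intro i
      by_cases hij : j = i
      · subst hij
        refine (E j).subset_mem hN ?_
        rintro ⟨a, b⟩ ⟨⟨a', b'⟩, hab, h⟩
        simp only [Prod.map_apply, Prod.mk.injEq, Sigma.mk.injEq, heq_eq_eq, true_and] at h
        rwa [← h.1, ← h.2]
      · refine (E i).subset_mem (E i).empty_mem ?_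
        rintro ⟨a, b⟩ ⟨⟨a', b'⟩, hab, h⟩
        simp [hij] at h
    · refine (Set.finite_singleton j).subset fun i hi => ?_
      by_contra hij
      refine hi ?_
      rintro ⟨a, b⟩ ⟨⟨a', b'⟩, hab, h⟩
      simp only [Prod.map_apply, Prod.mk.injEq, Sigma.mk.injEq] at h
      exact absurd h.1.1.symm hij
  · rintro ⟨h1, h2, h3⟩
    refine (coprod E).subset_mem ((coprod E).union_mem (coprod E).diag_mem
      ((coprod E).biUnion_mem h3.toFinset fun j _ =>
        coarselyUniform_sigmaMk E j _ (h2 j))) ?_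
    rintro ⟨⟨j, a⟩, ⟨j', b⟩⟩ hab
    obtain rfl : j = j' := h1 _ _ hab
    by_cases hj : component M j ⊆ SetRel.id
    · left
      have : a = b := hj (a := (a, b)) hab
      rw [this]
      rfl
    · right
      refine Set.mem_biUnion (x := j) (by simpa using hj) ?_
      exact mk_mem_mapRel (Sigma.mk j) (M := component M j) (x := a) (y := b) hab

end Coprod

/-! ### Colourings with bounded monochromatic components -/

/-- The relation of being connected by a finite chain of `r`-steps. -/
def chains (r : X → X → Prop) : SetRel X X := {p | Relation.ReflTransGen r p.1 p.2}

theorem chains_mono {r s : X → X → Prop} (h : ∀ x y, r x y → s x y) : chains r ⊆ chains s :=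
  fun _ hp => Relation.ReflTransGen.mono (fun x y hxy => h x y hxy) _ _ hp

theorem chains_symm {r : X → X → Prop} (h : ∀ x y, r x y → r y x) {x y : X}
    (hxy : (x, y) ∈ chains r) : (y, x) ∈ chains r := by
  replace hxy : Relation.ReflTransGen r x y := hxy
  induction hxy with
  | refl => exact Relation.ReflTransGen.refl
  | tail _ hbc ih => exact Relation.ReflTransGen.head (h _ _ hbc) ih

theorem eq_of_mem_chains {r : X → X → Prop} {f : X → Y} (h : ∀ x y, r x y → f x = f y) {x y : X}
    (hxy : (x, y) ∈ chains r) : f x = f y := by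
  replace hxy : Relation.ReflTransGen r x y := hxy
  induction hxy with
  | refl => rfl
  | tail _ hbc ih => exact ih.trans (h _ _ hbc)

/-- The colour is constant along a monochromatic chain. -/
theorem mem_chains_color {L : SetRel X X} {c : X → Y} {x y : X}
    (hxy : (x, y) ∈ chains fun a b => (a, b) ∈ L ∧ c a = c b) :
    (x, y) ∈ chains fun a b => (a, b) ∈ L ∧ c a = c x ∧ c b = c x := by
  replace hxy : Relation.ReflTransGen (fun a b => (a, b) ∈ L ∧ c a = c b) x y := hxy
  induction hxy with
  | refl => exact Relation.ReflTransGen.refl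
  | tail hxb hbd ih =>
    have h := eq_of_mem_chains (f := c) (fun _ _ h => h.2) hxb
    exact Relation.ReflTransGen.tail ih ⟨hbd.1, h.symm, hbd.2.symm.trans h.symm⟩

/-- The colouring form of `asdim ≤ n`: for every entourage `L` there is a colouring with `n + 1`
colours such that points connected by monochromatic `L`-chains are uniformly close. -/
def ColoredLE (E : CoarseStructure X) (n : ℕ) : Prop :=
  ∀ L ∈ E.entourages, ∃ c : X → Fin (n + 1),
    chains (fun a b => (a, b) ∈ L ∧ c a = c b) ∈ E.entourages

theorem ColoredLE.mono {E : CoarseStructure X} {m n : ℕ} (h : E.ColoredLE m) (hmn : m ≤ n) :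
    E.ColoredLE n := by
  intro L hL
  obtain ⟨c, hc⟩ := h L hL
  refine ⟨fun x => Fin.castLE (by omega) (c x), E.subset_mem hc (chains_mono ?_)⟩
  rintro x y ⟨h, h'⟩
  exact ⟨h, Fin.castLE_injective _ h'⟩

/-- Take the `N`-neighbourhoods of the monochromatic components for `N.comp N`. If two of the same
colour share a point, their components contain `N.comp N`-close points of that colour and so
coincide. Hence a point lies in at most one member per colour. -/
theorem ColoredLE.asdimLE {E : CoarseStructure X} {n : ℕ} (h : E.ColoredLE n) : E.AsdimLE n := by
  classical
  intro L hL
  obtain ⟨N, hN, hLN, hrefl, hsymm⟩ := exists_symm hL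
  obtain ⟨c, hc⟩ := h (N.comp N) (E.comp_mem hN hN)
  set r : X → X → Prop := fun a b => (a, b) ∈ N.comp N ∧ c a = c b with hr
  let V : X → Set X := fun x => {y | ∃ z, (z, x) ∈ chains r ∧ (y, z) ∈ N}
  have hrs : ∀ a b, r a b → r b a := by
    rintro a b ⟨⟨d, h1, h2⟩, h3⟩
    exact ⟨⟨d, hsymm _ _ h2, hsymm _ _ h1⟩, h3.symm⟩
  have hchs : ∀ {a b}, (a, b) ∈ chains r → (b, a) ∈ chains r := fun h =>
    chains_symm hrs h
  have hcol : ∀ {a b}, (a, b) ∈ chains r → c a = c b :=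
    fun hab => eq_of_mem_chains (f := c) (fun _ _ h => h.2) hab
  have hV : ∀ x x' y, y ∈ V x → y ∈ V x' → c x = c x' → V x = V x' := by
    rintro x x' y ⟨z, hz, hyz⟩ ⟨z', hz', hyz'⟩ hcc
    have hzz' : (z, z') ∈ chains r := Relation.ReflTransGen.single
      ⟨⟨y, hsymm _ _ hyz, hyz'⟩, ((hcol hz).trans hcc).trans (hcol hz').symm⟩
    have hxx' : (x, x') ∈ chains r := ((hchs hz).trans hzz').trans hz'
    ext w
    exact ⟨fun ⟨u, hu, hw⟩ => ⟨u, Relation.ReflTransGen.trans hu hxx', hw⟩,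
      fun ⟨u, hu, hw⟩ => ⟨u, Relation.ReflTransGen.trans hu (hchs hxx'), hw⟩⟩
  have hself : ∀ x, slice L x ⊆ V x := fun x y hy => ⟨x, Relation.ReflTransGen.refl, hLN hy⟩
  refine ⟨Set.range V, ?_, ?_, fun x => ⟨V x, ⟨x, rfl⟩, hself x⟩, ?_⟩
  · refine Set.eq_univ_of_forall fun x => ⟨V x, ⟨x, rfl⟩, x, Relation.ReflTransGen.refl, hrefl x⟩
  · intro y
    let g : Fin (n + 1) → Set X := fun i => if h : ∃ x, c x = i ∧ y ∈ V x then V h.choose else ∅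
    have hsub : {W ∈ Set.range V | y ∈ W} ⊆ Set.range g := by
      rintro _ ⟨⟨x, rfl⟩, hy⟩
      have hex : ∃ x', c x' = c x ∧ y ∈ V x' := ⟨x, rfl, hy⟩
      refine ⟨c x, ?_⟩
      simp only [g, dif_pos hex]
      exact hV _ _ y hex.choose_spec.2 hy hex.choose_spec.1
    refine (Set.encard_le_encard hsub).trans ?_
    rw [← Set.image_univ]
    refine (Set.encard_image_le _ _).trans ?_
    simp
  · refine E.subset_mem (E.comp_mem (E.comp_mem hN (E.comp_mem hc hc)) hN) ?_
    rintro ⟨a, b⟩ hab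
    simp only [Set.mem_iUnion] at hab
    obtain ⟨_, ⟨x, rfl⟩, ⟨z, hz, haz⟩, ⟨z', hz', hbz'⟩⟩ := hab
    exact ⟨z', ⟨z, haz, x, hz, hchs hz'⟩, hsymm _ _ hbz'⟩

/-- A form of the union theorem: the colouring of the complement of `A` is chosen first. -/
theorem exists_coloring_union {E : CoarseStructure X} {ι : Type*} (A : Set X) {L : SetRel X X}
    (hL : L ∈ E.entourages) (cB : X → ι)
    (hB : chains (fun a b => (a, b) ∈ L ∧ a ∉ A ∧ b ∉ A ∧ cB a = cB b) ∈ E.entourages)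
    (hA : ∀ L' ∈ E.entourages, ∃ cA : X → ι,
      chains (fun a b => (a, b) ∈ L' ∧ a ∈ A ∧ b ∈ A ∧ cA a = cA b) ∈ E.entourages) :
    ∃ c : X → ι, chains (fun a b => (a, b) ∈ L ∧ c a = c b) ∈ E.entourages := by
  classical
  set B := chains (fun a b => (a, b) ∈ L ∧ a ∉ A ∧ b ∉ A ∧ cB a = cB b) with hBdef
  -- An excursion out of `A` is a step to the complement, a `B`-chain there and a step back. Since
  -- `cA` is chosen after `cB`, the whole excursion can be made a single step for the entourage that
  -- `cA` has to handle.
  obtain ⟨cA, hcA⟩ := hA (L ∪ L.comp (B.comp L)) (E.union_mem hL (E.comp_mem hL (E.comp_mem hB hL)))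
  set K := chains (fun a b => (a, b) ∈ L ∪ L.comp (B.comp L) ∧ a ∈ A ∧ b ∈ A ∧ cA a = cA b)
    with hK
  let c : X → ι := fun x => if x ∈ A then cA x else cB x
  refine ⟨c, E.subset_mem (E.union_mem hB (E.comp_mem (E.union_mem E.diag_mem (E.comp_mem hB hL))
    (E.comp_mem hcA (E.union_mem E.diag_mem (E.comp_mem hL hB))))) (M := _)
    (N := B ∪ (SetRel.id ∪ B.comp L).comp (K.comp (SetRel.id ∪ L.comp B))) ?_⟩
  have hcA' : ∀ {x}, x ∈ A → c x = cA x := fun h => if_pos h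
  have hcB' : ∀ {x}, x ∉ A → c x = cB x := fun h => if_neg h
  -- Invariant along a chain: the first visit `a` to `A` and, while the chain is outside, the last
  -- visit `a'` with the excursion made since. The clause `c x = c a'` makes the return to `A` a
  -- monochromatic step of `K`.
  have key : ∀ x y, Relation.ReflTransGen (fun a b => (a, b) ∈ L ∧ c a = c b) x y →
      c x = c y ∧ ((y ∈ A ∧ ∃ a, (x, a) ∈ SetRel.id ∪ B.comp L ∧ (a, y) ∈ K) ∨
        (y ∉ A ∧ ((x ∉ A ∧ (x, y) ∈ B) ∨ ∃ a a', (x, a) ∈ SetRel.id ∪ B.comp L ∧ (a, a') ∈ K ∧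
          c x = c a' ∧ a' ∈ A ∧ (a', y) ∈ L.comp B))) := by
    intro x y hxy
    induction hxy with
    | refl =>
      refine ⟨rfl, ?_⟩
      by_cases hx : x ∈ A
      · exact Or.inl ⟨hx, x, Or.inl rfl, Relation.ReflTransGen.refl⟩
      · exact Or.inr ⟨hx, Or.inl ⟨hx, Relation.ReflTransGen.refl⟩⟩
    | @tail y z _ hyz ih =>
      obtain ⟨hcol, ih⟩ := ih
      have hcol' := hcol.trans hyz.2
      refine ⟨hcol', ?_⟩
      by_cases hz : z ∈ A
      · refine Or.inl ⟨hz, ?_⟩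
        rcases ih with ⟨hy, a, ha, hK1⟩ | ⟨hy, ⟨hx, hB1⟩ | ⟨a, a', ha, hK1, hca, ha', b, hb, hB1⟩⟩
        · refine ⟨a, ha, Relation.ReflTransGen.tail hK1 ⟨Or.inl hyz.1, hy, hz, ?_⟩⟩
          rw [← hcA' hy, ← hcA' hz]
          exact hyz.2
        · exact ⟨z, Or.inr ⟨y, hB1, hyz.1⟩, Relation.ReflTransGen.refl⟩
        · refine ⟨a, ha, Relation.ReflTransGen.tail hK1
            ⟨Or.inr ⟨b, hb, y, hB1, hyz.1⟩, ha', hz, ?_⟩⟩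
          rw [← hcA' ha', ← hcA' hz]
          exact hca.symm.trans hcol'
      · refine Or.inr ⟨hz, ?_⟩
        rcases ih with ⟨hy, a, ha, hK1⟩ | ⟨hy, ⟨hx, hB1⟩ | ⟨a, a', ha, hK1, hca, ha', b, hb, hB1⟩⟩
        · exact Or.inr ⟨a, y, ha, hK1, hcol, hy, z, hyz.1, Relation.ReflTransGen.refl⟩
        · refine Or.inl ⟨hx, Relation.ReflTransGen.tail hB1 ⟨hyz.1, hy, hz, ?_⟩⟩
          rw [← hcB' hy, ← hcB' hz]
          exact hyz.2
        · refine Or.inr ⟨a, a', ha, hK1, hca, ha', b, hb,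
            Relation.ReflTransGen.tail hB1 ⟨hyz.1, hy, hz, ?_⟩⟩
          rw [← hcB' hy, ← hcB' hz]
          exact hyz.2
  rintro ⟨x, y⟩ hxy
  rcases (key x y hxy).2 with ⟨_, a, ha, hK1⟩ | ⟨_, ⟨_, hB1⟩ | ⟨a, a', ha, hK1, _, _, h⟩⟩
  · exact Or.inr ⟨a, ha, y, hK1, Or.inl rfl⟩
  · exact Or.inl hB1
  · exact Or.inr ⟨a, ha, a', hK1, Or.inr h⟩

/-- A chain never leaves its summand, and where `L` is diagonal all chains are constant. So only
finitely many summands contribute off the diagonal, and they can be coloured independently. -/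
theorem ColoredLE.coprod {J : Type*} {W : J → Type*} {E : ∀ j, CoarseStructure (W j)} {n : ℕ}
    (h : ∀ j, (E j).ColoredLE n) : (CoarseStructure.coprod E).ColoredLE n := by
  intro L hL
  obtain ⟨h1, h2, h3⟩ := mem_coprod_iff.1 hL
  choose c hc using fun j => h j _ (h2 j)
  refine ⟨fun x => c x.1 x.2, mem_coprod_iff.2 ?_⟩
  have key : ∀ j (x : W j) (b : Σ j, W j), Relation.ReflTransGen
      (fun a b : Σ j, W j => (a, b) ∈ L ∧ c a.1 a.2 = c b.1 b.2) ⟨j, x⟩ b →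
      ∃ y : W j, b = ⟨j, y⟩ ∧ (x, y) ∈ chains fun a b => (a, b) ∈ component L j ∧ c j a = c j b := by
    intro j x b hb
    induction hb with
    | refl => exact ⟨x, rfl, Relation.ReflTransGen.refl⟩
    | @tail b d _ hbd ih =>
      obtain ⟨y, rfl, hy⟩ := ih
      obtain ⟨j', z⟩ := d
      obtain rfl : j = j' := h1 _ _ hbd.1
      exact ⟨z, rfl, Relation.ReflTransGen.tail hy hbd⟩
  have key' : ∀ j, component (chains fun a b : Σ j, W j => (a, b) ∈ L ∧ c a.1 a.2 = c b.1 b.2) j ⊆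
      chains fun a b => (a, b) ∈ component L j ∧ c j a = c j b := by
    rintro j ⟨x, y⟩ hxy
    obtain ⟨y', hy, hxy'⟩ := key j x _ hxy
    obtain rfl : y = y' := eq_of_heq (Sigma.mk.inj hy).2
    exact hxy'
  refine ⟨?_, fun j => (E j).subset_mem (hc j) (key' j), h3.subset ?_⟩
  · rintro ⟨j, x⟩ b hab
    obtain ⟨y, rfl, _⟩ := key j x b hab
    rfl
  · intro j hj hid
    refine hj ((key' j).trans ?_)
    rintro ⟨x, y⟩ hxy
    exact eq_of_mem_chains (f := id) (fun _ _ h => hid h.1) hxy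

/-! ### Products by way of avoided colours -/

/-- For every entourage `L` there is a colouring with `m` colours such that, for every colour `i`,
the points connected by `L`-chains that avoid the colour `i` are uniformly close. -/
def AvoidLE (E : CoarseStructure X) (m : ℕ) : Prop :=
  ∀ L ∈ E.entourages, ∃ b : X → Fin m, ∀ i,
    chains (fun x y => (x, y) ∈ L ∧ b x ≠ i ∧ b y ≠ i) ∈ E.entourages

theorem mem_chains_map (f : X → Y) {r : X → X → Prop} {s : Y → Y → Prop}
    (h : ∀ x y, r x y → s (f x) (f y)) {x y : X} (hxy : (x, y) ∈ chains r) :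
    (f x, f y) ∈ chains s := by
  replace hxy : Relation.ReflTransGen r x y := hxy
  induction hxy with
  | refl => exact Relation.ReflTransGen.refl
  | tail _ hbc ih => exact Relation.ReflTransGen.tail ih (h _ _ hbc)

/-- The `n + 1` coordinates of a point use at most `n + 1` of the `n + 2` colours, and the point
gets an unused one. A monochromatic chain of colour `i` then projects in every factor to a chain
that avoids `i`. -/
theorem AvoidLE.pi_prod_coloredLE {n : ℕ} {F : Fin n → Type*} {E : ∀ j, CoarseStructure (F j)}
    {G : CoarseStructure Y} (hE : ∀ j, (E j).AvoidLE (n + 2)) (hG : G.AvoidLE (n + 2)) :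
    ((CoarseStructure.pi E).prod G).ColoredLE (n + 1) := by
  classical
  intro L hL
  choose b hb using fun j => hE j _ (hL.1 j)
  obtain ⟨d, hd⟩ := hG _ hL.2
  have hex : ∀ x : (∀ j, F j) × Y, ∃ i : Fin (n + 2), (∀ j, b j (x.1 j) ≠ i) ∧ d x.2 ≠ i := by
    intro x
    have hcard : (insert (d x.2) (Finset.univ.image fun j => b j (x.1 j))).card < n + 2 := by
      refine (Finset.card_insert_le _ _).trans_lt ?_
      have := Finset.card_image_le (s := Finset.univ) (f := fun j => b j (x.1 j))
      simp only [Finset.card_univ, Fintype.card_fin] at this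
      omega
    obtain ⟨i, hi⟩ : ∃ i, i ∉ insert (d x.2) (Finset.univ.image fun j => b j (x.1 j)) := by
      by_contra! h
      rw [Finset.eq_univ_iff_forall.2 h] at hcard
      simp at hcard
    simp only [Finset.mem_insert, Finset.mem_image, Finset.mem_univ, true_and, not_or,
      not_exists] at hi
    exact ⟨i, hi.2, fun h => hi.1 h.symm⟩
  choose c hc hc' using hex
  refine ⟨c, fun j => ?_, ?_⟩
  · refine (E j).subset_mem ((E j).biUnion_mem Finset.univ fun i _ => hb j i) ?_
    rw [mapRel_mapRel]
    refine mapRel_subset fun x y hxy => Set.mem_biUnion (x := c x) (by simp) ?_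
    refine mem_chains_map (fun z : (∀ j, F j) × Y => z.1 j) ?_ (mem_chains_color hxy)
    rintro z w ⟨hzw, hz, hw⟩
    exact ⟨mk_mem_mapRel _ (mk_mem_mapRel Prod.fst hzw), hz ▸ hc z j, hw ▸ hc w j⟩
  · refine G.subset_mem (G.biUnion_mem Finset.univ fun i _ => hd i) ?_
    refine mapRel_subset fun x y hxy => Set.mem_biUnion (x := c x) (by simp) ?_
    refine mem_chains_map Prod.snd ?_ (mem_chains_color hxy)
    rintro z w ⟨hzw, hz, hw⟩
    exact ⟨mk_mem_mapRel Prod.snd hzw, hz ▸ hc' z, hw ▸ hc' w⟩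

theorem IsConnected.singleton_mem {E : CoarseStructure X} (hE : E.IsConnected) (p : X × X) :
    ({p} : SetRel X X) ∈ E.entourages := by
  obtain ⟨M, hM, hp⟩ := hE p
  exact E.subset_mem hM (Set.singleton_subset_iff.2 hp)

/-! ### Rays -/

namespace IsRay

variable {R : CoarseStructure ℝ≥0}

/-- A neighbourhood of the diagonal contains a small square at the origin, and adding an entourage
to itself doubles its reach; finitely many doublings exceed `c`. -/
theorem Icc_zero_mem (hR : R.IsRay) (c : ℝ≥0) :
    ({p | p.1 = 0 ∧ p.2 ≤ c} : SetRel ℝ≥0 ℝ≥0) ∈ R.entourages := by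
  obtain ⟨N, hN, hdiag⟩ := hR.compatible.nhds_diag
  have h0 : N ∈ nhds ((0 : ℝ≥0), (0 : ℝ≥0)) := mem_nhdsSet_iff_forall.1 hdiag (0, 0) rfl
  rw [nhds_prod_eq, Filter.mem_prod_same_iff] at h0
  obtain ⟨t, ht, htN⟩ := h0
  obtain ⟨ε, hε, hεt⟩ := NNReal.nhds_zero_basis.mem_iff.1 ht
  have hstep : ∀ k : ℕ, ({p | p.1 = 0 ∧ p.2 ≤ 2 ^ k * (ε / 2)} : SetRel ℝ≥0 ℝ≥0) ∈
      R.entourages := by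
    intro k
    induction k with
    | zero =>
      refine R.subset_mem hN ?_
      rintro ⟨a, b⟩ ⟨ha, hb⟩
      simp only [pow_zero, one_mul] at ha hb
      subst ha
      exact htN ⟨hεt hε, hεt (hb.trans_lt (NNReal.half_lt_self (ne_of_gt hε)))⟩
    | succ k ih =>
      refine R.subset_mem (hR.add_mem _ ih _ ih) ?_
      rintro ⟨a, b⟩ ⟨ha, hb⟩
      simp only at ha hb
      have hb2 : b / 2 ≤ 2 ^ k * (ε / 2) := by
        rw [div_le_iff₀ (by norm_num)]
        calc b ≤ 2 ^ (k + 1) * (ε / 2) := hb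
          _ = _ := by ring
      refine ⟨(0, b / 2), ⟨rfl, hb2⟩, (0, b / 2), ⟨rfl, hb2⟩, ?_⟩
      simp [ha]
  obtain ⟨k, hk⟩ := pow_unbounded_of_one_lt (c / (ε / 2)) (one_lt_two (α := ℝ≥0))
  refine R.subset_mem (hstep k) ?_
  rintro ⟨a, b⟩ ⟨ha, hb⟩
  refine ⟨ha, hb.trans ?_⟩
  rw [div_lt_iff₀ (half_pos hε)] at hk
  exact hk.le

/-- The coarse structure of a ray contains all the metric entourages. -/
theorem metric_mem (hR : R.IsRay) (c : ℝ≥0) :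
    ({p | p.1 ≤ p.2 + c ∧ p.2 ≤ p.1 + c} : SetRel ℝ≥0 ℝ≥0) ∈ R.entourages := by
  have h := hR.add_mem _ R.diag_mem _ (hR.Icc_zero_mem c)
  refine R.subset_mem (R.union_mem h (R.inv_mem h)) ?_
  rintro ⟨a, b⟩ ⟨hab, hba⟩
  rcases le_total a b with hle | hle
  · left
    refine ⟨(a, a), rfl, (0, b - a), ⟨rfl, tsub_le_iff_left.2 hba⟩, ?_⟩
    simp [add_tsub_cancel_of_le hle]
  · right
    refine ⟨(b, b), rfl, (0, a - b), ⟨rfl, tsub_le_iff_left.2 hab⟩, ?_⟩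
    simp [add_tsub_cancel_of_le hle]

theorem prod_Iic_mem (hR : R.IsRay) (c : ℝ≥0) :
    ({p | p.1 ≤ c ∧ p.2 ≤ c} : SetRel ℝ≥0 ℝ≥0) ∈ R.entourages :=
  R.subset_mem (hR.metric_mem c) fun _ hp =>
    ⟨hp.1.trans le_add_self, hp.2.trans le_add_self⟩

/-- Every entourage is controlled by a growth function whose graph is an entourage. -/
theorem exists_growth (hR : R.IsRay) {L : SetRel ℝ≥0 ℝ≥0} (hL : L ∈ R.entourages) :
    ∃ K ∈ R.entourages, ∃ h : ℝ≥0 → ℝ≥0, ∀ t, (h t, t) ∈ K ∧ t + 1 ≤ h t ∧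
      ∀ a b, (a, b) ∈ L → b ≤ t → a < h t := by
  set L' := {p : ℝ≥0 × ℝ≥0 | ∃ q ∈ L, (q.1 ≤ p.1 ∧ p.1 ≤ p.2 ∧ p.2 ≤ q.2) ∨
      (q.2 ≤ p.2 ∧ p.2 ≤ p.1 ∧ p.1 ≤ q.1)} ∪ SetRel.id with hL'
  have hL'mem : L' ∈ R.entourages := R.union_mem (hR.between_mem L hL) R.diag_mem
  -- The supremum is finite because bounded sets have compact closure, and some point of the slice
  -- lies within `1` of it. The added `1` makes the bound strict and lets `h` grow; together this
  -- explains the `2`.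
  refine ⟨_, R.comp_mem (hR.metric_mem 2) hL'mem, fun t => sSup (slice L' t) + 1, fun t => ?_⟩
  have hbdd : BddAbove (slice L' t) :=
    (hR.compatible.compact_closure _ ⟨L', hL'mem, t, rfl⟩).bddAbove.mono subset_closure
  have ht : t ∈ slice L' t := Or.inr rfl
  refine ⟨?_, add_le_add (le_csSup hbdd ht) le_rfl, fun a b hab hbt => ?_⟩
  · obtain ⟨a, ha, hlt⟩ : ∃ a ∈ slice L' t, sSup (slice L' t) ≤ a + 1 := by
      by_contra! hcon
      have h1 : (1 : ℝ≥0) ≤ sSup (slice L' t) := le_add_self.trans (hcon t ht).le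
      have h2 : sSup (slice L' t) ≤ sSup (slice L' t) - 1 :=
        csSup_le ⟨t, ht⟩ fun a ha => le_tsub_of_add_le_right (hcon a ha).le
      have h3 : sSup (slice L' t) - 1 < sSup (slice L' t) :=
        tsub_lt_self (zero_lt_one.trans_le h1) zero_lt_one
      exact absurd h2 (not_le.2 h3)
    refine ⟨a, ⟨?_, ?_⟩, ha⟩
    · calc sSup (slice L' t) + 1 ≤ a + 1 + 1 := add_le_add hlt le_rfl
        _ = a + 2 := by ring
    · exact (le_csSup hbdd ha).trans (by rw [add_assoc]; exact le_self_add)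
  · rcases le_total a t with h | h
    · exact (h.trans (le_csSup hbdd ht)).trans_lt (lt_add_one _)
    · refine (le_csSup hbdd ?_).trans_lt (lt_add_one _)
      exact Or.inl ⟨(a, b), hab, Or.inr ⟨hbt, h, le_rfl⟩⟩

theorem exists_bound (hR : R.IsRay) {L : SetRel ℝ≥0 ℝ≥0} (hL : L ∈ R.entourages) (t : ℝ≥0) :
    ∃ s, t ≤ s ∧ ∀ a b, (a, b) ∈ L ∨ (b, a) ∈ L → b ≤ t → a ≤ s := by
  obtain ⟨K, -, h, hh⟩ := hR.exists_growth (R.union_mem hL (R.inv_mem hL))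
  exact ⟨h t, le_self_add.trans (hh t).2.1, fun a b hab hbt => ((hh t).2.2 a b hab hbt).le⟩

/-- Every entourage `L` admits a partition of the ray into consecutive intervals, indexed by
natural numbers, such that `L` relates only points of equal or adjacent intervals and the intervals
are uniformly bounded. -/
theorem exists_index (hR : R.IsRay) {L : SetRel ℝ≥0 ℝ≥0} (hL : L ∈ R.entourages) :
    ∃ κ : ℝ≥0 → ℕ, (∀ a b, (a, b) ∈ L → κ a ≤ κ b + 1 ∧ κ b ≤ κ a + 1) ∧
      ∀ m : ℕ, {p : ℝ≥0 × ℝ≥0 | κ p.1 ≤ κ p.2 + m ∧ κ p.2 ≤ κ p.1 + m} ∈ R.entourages := by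
  obtain ⟨N, hN, hLN, -, hsymm⟩ := exists_symm hL
  obtain ⟨K, hK, h, hh⟩ := hR.exists_growth hN
  -- Breakpoints `0, h 0, h (h 0), …`: the gaps are at least `1`, so they exhaust the ray, and
  -- consecutive breakpoints are `K`-related, so the intervals are uniformly bounded.
  let t : ℕ → ℝ≥0 := fun k => Nat.rec 0 (fun _ s => h s) k
  have htsucc : ∀ k, t (k + 1) = h (t k) := fun _ => rfl
  have htk : ∀ k : ℕ, (k : ℝ≥0) ≤ t k := by
    intro k
    induction k with
    | zero => simp
    | succ k ih =>
      push_cast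
      exact (add_le_add ih le_rfl).trans (hh (t k)).2.1
  have hmono : Monotone t := monotone_nat_of_le_succ fun k => le_self_add.trans (hh (t k)).2.1
  have hex : ∀ s : ℝ≥0, ∃ k, s < t (k + 1) := by
    intro s
    obtain ⟨k, hk⟩ := exists_nat_gt s
    exact ⟨k, hk.trans_le ((htk k).trans (hmono (Nat.le_succ k)))⟩
  classical
  let κ : ℝ≥0 → ℕ := fun s => Nat.find (hex s)
  have hlt : ∀ s, s < t (κ s + 1) := fun s => Nat.find_spec (hex s)
  have hle : ∀ s, t (κ s) ≤ s := by
    intro s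
    rcases hκ : κ s with _ | k
    · exact zero_le
    · exact not_lt.1 (Nat.find_min (hex s) (m := k) (by change k < κ s; omega))
  have hκ : ∀ {s k}, s < t (k + 1) → κ s ≤ k := fun h => Nat.find_min' (hex _) h
  refine ⟨κ, ?_, fun m => ?_⟩
  · have : ∀ a b, (a, b) ∈ N → κ a ≤ κ b + 1 :=
      fun a b hab => hκ ((hh (t (κ b + 1))).2.2 a b hab (hlt b).le)
    exact fun a b hab => ⟨this a b (hLN hab), this b a (hsymm _ _ (hLN hab))⟩
  · have hK2 := hR.between_mem K hK
    have h1 : ({p | p.2 = t (κ p.1)} : SetRel ℝ≥0 ℝ≥0) ∈ R.entourages := by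
      refine R.subset_mem hK2 ?_
      rintro ⟨a, b⟩ hab
      obtain rfl : b = t (κ a) := hab
      exact ⟨(t (κ a + 1), t (κ a)), (hh _).1, Or.inr ⟨le_rfl, hle a, (hlt a).le⟩⟩
    have h2 : ∀ i : ℕ, ({p | ∃ k, p = (t (k + i), t k)} : SetRel ℝ≥0 ℝ≥0) ∈ R.entourages := by
      intro i
      induction i with
      | zero =>
        refine R.subset_mem R.diag_mem ?_
        rintro _ ⟨k, rfl⟩
        rfl
      | succ i ih =>
        refine R.subset_mem (R.comp_mem hK ih) ?_
        rintro _ ⟨k, rfl⟩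
        exact ⟨t (k + i), (hh _).1, k, rfl⟩
    have h3 : (⋃ i ∈ Finset.range (m + 1), {p : ℝ≥0 × ℝ≥0 | κ p.1 = κ p.2 + i}) ∈
        R.entourages := by
      refine R.biUnion_mem _ fun i _ => ?_
      refine R.subset_mem (R.comp_mem h1 (R.comp_mem (h2 i) (R.inv_mem h1))) ?_
      rintro ⟨a, b⟩ hab
      change κ a = κ b + i at hab
      refine ⟨t (κ a), rfl, t (κ b), ⟨κ b, ?_⟩, rfl⟩
      rw [hab]
    refine R.subset_mem (R.union_mem h3 (R.inv_mem h3)) ?_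
    rintro ⟨a, b⟩ ⟨hab, hba⟩
    simp only at hab hba
    rcases le_total (κ a) (κ b) with hle | hle
    · right
      refine Set.mem_biUnion (x := κ b - κ a) (Finset.mem_coe.2 (Finset.mem_range.2 (by omega))) ?_
      change κ b = κ a + (κ b - κ a)
      omega
    · left
      refine Set.mem_biUnion (x := κ a - κ b) (Finset.mem_coe.2 (Finset.mem_range.2 (by omega))) ?_
      change κ a = κ b + (κ a - κ b)
      omega

/-- The intervals are coloured cyclically. An `L`-step changes the index by at most one, so a chain
that avoids the residue `i` cannot jump over an interval of that colour and stays in a run of at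
most `m` intervals. -/
theorem avoidLE (hR : R.IsRay) (m : ℕ) : R.AvoidLE (m + 1) := by
  intro L hL
  obtain ⟨κ, hκL, hκ⟩ := hR.exists_index hL
  refine ⟨fun s => Fin.ofNat (m + 1) (κ s), fun i => ?_⟩
  -- The shift by `m + 1 - i`, which is positive, turns the residue `i` into divisibility by `m +
  -- 1`. On the indices of other residues, the runs between intervals of colour `i` become the
  -- fibres of division by `m + 1`.
  have hdvd : ∀ s, Fin.ofNat (m + 1) (κ s) ≠ i → ¬ (m + 1 ∣ κ s + (m + 1 - i)) := by
    intro s hs hd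
    refine hs (Fin.ext ?_)
    obtain ⟨q, hq⟩ := hd
    have hi := i.isLt
    rw [Fin.val_ofNat]
    obtain ⟨q, rfl⟩ : ∃ r, q = r + 1 := ⟨q - 1, by
      rcases q with _ | q
      · omega
      · omega⟩
    have : κ s = i + (m + 1) * q := by
      rw [mul_add] at hq
      omega
    rw [this, Nat.add_mul_mod_self_left, Nat.mod_eq_of_lt hi]
  have hdiv : ∀ a b : ℕ, a ≤ b + 1 → b ≤ a + 1 → ¬ (m + 1 ∣ a) → ¬ (m + 1 ∣ b) →
      a / (m + 1) = b / (m + 1) := by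
    intro a b hab hba ha hb
    rcases (by omega : a = b ∨ a = b + 1 ∨ b = a + 1) with rfl | rfl | rfl
    · rfl
    · rw [Nat.succ_div, if_neg ha, add_zero]
    · rw [Nat.succ_div, if_neg hb, add_zero]
  refine R.subset_mem (hκ (m + 1)) ?_
  rintro ⟨x, y⟩ hxy
  have h := eq_of_mem_chains (f := fun s => (κ s + (m + 1 - i)) / (m + 1)) (fun a b hab => by
    have h1 := hκL a b hab.1
    exact hdiv _ _ (by omega) (by omega) (hdvd a hab.2.1) (hdvd b hab.2.2)) hxy
  have h1 := Nat.div_add_mod (κ x + (m + 1 - i)) (m + 1)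
  have h2 := Nat.div_add_mod (κ y + (m + 1 - i)) (m + 1)
  have h3 := Nat.mod_lt (κ x + (m + 1 - i)) (show m + 1 > 0 by omega)
  have h4 := Nat.mod_lt (κ y + (m + 1 - i)) (show m + 1 > 0 by omega)
  rw [h] at h1
  constructor <;> simp only <;> omega

end IsRay

/-! ### The two structures on the doubled ray -/

/-- The folding map `R ⊔ R → R`. -/
def fold : ℝ≥0 ⊕ ℝ≥0 → ℝ≥0 := Sum.elim id id

/-- The relations on `R ⊔ R` that are entourages after folding and contain no pair of points from
different copies. -/
def separateExplicit (R : CoarseStructure ℝ≥0) : CoarseStructure (ℝ≥0 ⊕ ℝ≥0) where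
  entourages := {M | mapRel fold M ∈ R.entourages ∧ ∀ a b, (a, b) ∈ M → a.isLeft = b.isLeft}
  subset_mem hN h :=
    ⟨(R.comap fold).subset_mem hN.1 h, fun a b hab => hN.2 a b (h hab)⟩
  union_mem hM hN :=
    ⟨(R.comap fold).union_mem hM.1 hN.1, fun a b hab => hab.elim (hM.2 a b) (hN.2 a b)⟩
  diag_mem := ⟨(R.comap fold).diag_mem, fun _ _ hab => congrArg Sum.isLeft hab⟩
  inv_mem hM := ⟨(R.comap fold).inv_mem hM.1, fun a b hab => (hM.2 b a hab).symm⟩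
  comp_mem hM hN := by
    refine ⟨(R.comap fold).comp_mem hM.1 hN.1, ?_⟩
    rintro a c ⟨b, hab, hbc⟩
    exact (hM.2 _ _ hab).trans (hN.2 _ _ hbc)

/-- The relations on `R ⊔ R` that are entourages after folding and for which the pairs of points
from different copies lie in a bounded region. -/
def joinedExplicit {R : CoarseStructure ℝ≥0} (hR : R.IsRay) : CoarseStructure (ℝ≥0 ⊕ ℝ≥0) where
  entourages := {M | mapRel fold M ∈ R.entourages ∧
    ∃ T, ∀ a b, (a, b) ∈ M → a.isLeft ≠ b.isLeft → fold a ≤ T ∧ fold b ≤ T}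
  subset_mem := by
    rintro M N ⟨hN, T, hT⟩ h
    exact ⟨(R.comap fold).subset_mem hN h, T, fun a b hab => hT a b (h hab)⟩
  union_mem := by
    rintro M N ⟨hM, T, hT⟩ ⟨hN, T', hT'⟩
    refine ⟨(R.comap fold).union_mem hM hN, max T T', ?_⟩
    rintro a b (hab | hab) hne
    · exact ⟨(hT a b hab hne).1.trans (le_max_left _ _), (hT a b hab hne).2.trans (le_max_left _ _)⟩
    · exact ⟨(hT' a b hab hne).1.trans (le_max_right _ _),
        (hT' a b hab hne).2.trans (le_max_right _ _)⟩
  diag_mem := ⟨(R.comap fold).diag_mem, 0, fun _ _ hab hne => absurd (congrArg Sum.isLeft hab) hne⟩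
  inv_mem := by
    rintro M ⟨hM, T, hT⟩
    exact ⟨(R.comap fold).inv_mem hM, T, fun a b hab hne => (hT b a hab hne.symm).symm⟩
  comp_mem := by
    rintro M N ⟨hM, T, hT⟩ ⟨hN, T', hT'⟩
    refine ⟨(R.comap fold).comp_mem hM hN, ?_⟩
    obtain ⟨s, hs, hs'⟩ := hR.exists_bound hM T'
    obtain ⟨s', hs1, hs1'⟩ := hR.exists_bound hN T
    refine ⟨max s s', ?_⟩
    rintro a c ⟨b, hab, hbc⟩ hne
    by_cases h : a.isLeft = b.isLeft
    · have h' := hT' b c hbc (h ▸ hne)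
      exact ⟨(hs' _ _ (Or.inl (mk_mem_mapRel fold hab)) h'.1).trans (le_max_left _ _),
        (h'.2.trans hs).trans (le_max_left _ _)⟩
    · have h' := hT a b hab h
      exact ⟨(h'.1.trans hs1).trans (le_max_right _ _),
        (hs1' _ _ (Or.inr (mk_mem_mapRel fold hbc)) h'.2).trans (le_max_right _ _)⟩

section DoubleRay

variable {κ : DoubleKind} {R : CoarseStructure ℝ≥0}

theorem coarselyUniform_doubleRay_inl : CoarselyUniform R (doubleRay κ R) Sum.inl := by
  intro M hM
  cases κ with
  | coproduct => exact coarselyUniform_inl M hM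
  | connected => exact fun C _ hC => hC (coarselyUniform_inl M hM)

theorem coarselyUniform_doubleRay_inr : CoarselyUniform R (doubleRay κ R) Sum.inr := by
  intro M hM
  cases κ with
  | coproduct => exact coarselyUniform_inr M hM
  | connected => exact fun C _ hC => hC (coarselyUniform_inr M hM)

theorem sum_subset_separateExplicit :
    (R.sum R).entourages ⊆ (separateExplicit R).entourages := by
  refine sum_subset (fun M hM => ⟨?_, ?_⟩) (fun M hM => ⟨?_, ?_⟩)
  · rw [mapRel_mapRel]
    exact CoarselyUniform.refl R M hM
  · rintro _ _ ⟨_, _, h⟩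
    cases h
    rfl
  · rw [mapRel_mapRel]
    exact CoarselyUniform.refl R M hM
  · rintro _ _ ⟨_, _, h⟩
    cases h
    rfl

theorem joinedExplicit_isConnected (hR : R.IsRay) : (joinedExplicit hR).IsConnected := by
  rintro ⟨x, y⟩
  refine ⟨{(x, y)}, ⟨?_, max (fold x) (fold y), ?_⟩, rfl⟩
  · refine R.subset_mem (hR.connected.singleton_mem (fold x, fold y)) ?_
    rintro _ ⟨p, rfl, rfl⟩
    rfl
  · rintro a b hab -
    obtain ⟨rfl, rfl⟩ := Prod.mk.inj (Set.mem_singleton_iff.1 hab)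
    exact ⟨le_max_left _ _, le_max_right _ _⟩

theorem doubleRay_connected_subset (hR : R.IsRay) :
    (doubleRay .connected R).entourages ⊆ (joinedExplicit hR).entourages := by
  refine fun M hM => hM _ (joinedExplicit_isConnected hR) fun N hN => ?_
  obtain ⟨h1, h2⟩ := sum_subset_separateExplicit hN
  exact ⟨h1, 0, fun a b hab hne => absurd (h2 a b hab) hne⟩

theorem coarselyUniform_fold (hR : R.IsRay) : CoarselyUniform (doubleRay κ R) R fold := by
  intro M hM
  cases κ with
  | coproduct => exact (sum_subset_separateExplicit hM).1
  | connected => exact (doubleRay_connected_subset hR hM).1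

/-- Connectedness supplies the pair of the two origins, through which bounded parts of different
copies are joined. -/
theorem bounded_mem_doubleRay_connected (hR : R.IsRay) (T : ℝ≥0) :
    ({p | fold p.1 ≤ T ∧ fold p.2 ≤ T} : SetRel (ℝ≥0 ⊕ ℝ≥0) (ℝ≥0 ⊕ ℝ≥0)) ∈
      (doubleRay .connected R).entourages := by
  set E := doubleRay .connected R with hE
  have hl : mapRel Sum.inl {p : ℝ≥0 × ℝ≥0 | p.1 ≤ T ∧ p.2 ≤ T} ∈ E.entourages :=
    coarselyUniform_doubleRay_inl _ (hR.prod_Iic_mem T)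
  have hr : mapRel Sum.inr {p : ℝ≥0 × ℝ≥0 | p.1 ≤ T ∧ p.2 ≤ T} ∈ E.entourages :=
    coarselyUniform_doubleRay_inr _ (hR.prod_Iic_mem T)
  have h0 : ({(Sum.inl 0, Sum.inr 0)} : SetRel (ℝ≥0 ⊕ ℝ≥0) (ℝ≥0 ⊕ ℝ≥0)) ∈ E.entourages :=
    fun C hC _ => hC.singleton_mem _
  have hlr := E.comp_mem hl (E.comp_mem h0 hr)
  have h0T : (0 : ℝ≥0) ≤ T := zero_le
  refine E.subset_mem (E.union_mem (E.union_mem hl hr) (E.union_mem hlr (E.inv_mem hlr))) ?_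
  rintro ⟨a | a, b | b⟩ ⟨ha, hb⟩ <;> change a ≤ T at ha <;> change b ≤ T at hb
  · exact Or.inl (Or.inl (mk_mem_mapRel _ ⟨ha, hb⟩))
  · exact Or.inr (Or.inl ⟨Sum.inl 0, mk_mem_mapRel _ ⟨ha, h0T⟩, Sum.inr 0, rfl,
      mk_mem_mapRel _ ⟨h0T, hb⟩⟩)
  · exact Or.inr (Or.inr ⟨Sum.inl 0, mk_mem_mapRel _ ⟨hb, h0T⟩, Sum.inr 0, rfl,
      mk_mem_mapRel _ ⟨h0T, ha⟩⟩)
  · exact Or.inl (Or.inr (mk_mem_mapRel _ ⟨ha, hb⟩))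

/-- Serves to treat both choices alike: an entourage either does not mix the copies, or mixes them
only over a bounded part, and then all pairs over bounded parts are allowed. -/
theorem doubleRay_cross (hR : R.IsRay) {L : SetRel (ℝ≥0 ⊕ ℝ≥0) (ℝ≥0 ⊕ ℝ≥0)}
    (hL : L ∈ (doubleRay κ R).entourages) : (∀ a b, (a, b) ∈ L → a.isLeft = b.isLeft) ∨
      (∃ T, ∀ a b, (a, b) ∈ L → a.isLeft ≠ b.isLeft → fold a ≤ T ∧ fold b ≤ T) ∧
      ∀ T, {p : (ℝ≥0 ⊕ ℝ≥0) × (ℝ≥0 ⊕ ℝ≥0) | fold p.1 ≤ T ∧ fold p.2 ≤ T} ∈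
        (doubleRay κ R).entourages := by
  cases κ with
  | coproduct => exact Or.inl (sum_subset_separateExplicit hL).2
  | connected =>
    exact Or.inr ⟨(doubleRay_connected_subset hR hL).2, bounded_mem_doubleRay_connected hR⟩

theorem mem_doubleRay_of_fold {K : SetRel ℝ≥0 ℝ≥0} (hK : K ∈ R.entourages) :
    ({p | p.1.isLeft = p.2.isLeft ∧ (fold p.1, fold p.2) ∈ K} :
      SetRel (ℝ≥0 ⊕ ℝ≥0) (ℝ≥0 ⊕ ℝ≥0)) ∈ (doubleRay κ R).entourages := by
  refine (doubleRay κ R).subset_mem ((doubleRay κ R).union_mem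
    (coarselyUniform_doubleRay_inl K hK) (coarselyUniform_doubleRay_inr K hK)) ?_
  rintro ⟨a | a, b | b⟩ ⟨h, hab⟩
  · exact Or.inl (mk_mem_mapRel _ hab)
  · cases h
  · cases h
  · exact Or.inr (mk_mem_mapRel _ hab)

/-- The colouring of the ray is pulled back along `fold`. If a chain changes copies, it passes below
`T`; as its fold lies in the entourage `K`, both ends lie below a uniform `s`, where all pairs are
allowed. -/
theorem doubleRay_avoidLE (κ : DoubleKind) (hR : R.IsRay) (m : ℕ) :
    (doubleRay κ R).AvoidLE (m + 1) := by
  intro L hL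
  have hfold := coarselyUniform_fold hR L hL
  rcases doubleRay_cross hR hL with hsep | ⟨⟨T, hT⟩, hbdd⟩
  · obtain ⟨b, hb⟩ := hR.avoidLE m _ hfold
    refine ⟨fun x => b (fold x), fun i =>
      (doubleRay κ R).subset_mem (mem_doubleRay_of_fold (hb i)) ?_⟩
    rintro ⟨x, y⟩ hxy
    exact ⟨eq_of_mem_chains (f := Sum.isLeft) (fun _ _ h => hsep _ _ h.1) hxy,
      mem_chains_map fold (fun _ _ h => ⟨mk_mem_mapRel fold h.1, h.2⟩) hxy⟩
  · obtain ⟨b, hb⟩ := hR.avoidLE m _ (R.union_mem hfold (hR.prod_Iic_mem T))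
    refine ⟨fun x => b (fold x), fun i => ?_⟩
    set K := chains (fun x y => (x, y) ∈ mapRel fold L ∪ {p | p.1 ≤ T ∧ p.2 ≤ T} ∧
      b x ≠ i ∧ b y ≠ i) with hKdef
    obtain ⟨s, hs, hs'⟩ := hR.exists_bound (hb i) T
    refine (doubleRay κ R).subset_mem ((doubleRay κ R).union_mem
      (mem_doubleRay_of_fold (hb i)) (hbdd s)) ?_
    have key : ∀ x y, Relation.ReflTransGen
        (fun x y => (x, y) ∈ L ∧ b (fold x) ≠ i ∧ b (fold y) ≠ i) x y →
        (fold x, fold y) ∈ K ∧ (x.isLeft = y.isLeft ∨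
          (∃ u, u ≤ T ∧ (fold x, u) ∈ K) ∧ ∃ u, u ≤ T ∧ (u, fold y) ∈ K) := by
      intro x y hxy
      induction hxy with
      | refl => exact ⟨Relation.ReflTransGen.refl, Or.inl rfl⟩
      | @tail y z _ hyz ih =>
        obtain ⟨h1, h2⟩ := ih
        have hstep : ∀ {u}, (u, fold y) ∈ K → (u, fold z) ∈ K := fun h =>
          Relation.ReflTransGen.tail h ⟨Or.inl (mk_mem_mapRel fold hyz.1), hyz.2⟩
        refine ⟨hstep h1, ?_⟩
        by_cases hlr : y.isLeft = z.isLeft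
        · rcases h2 with h2 | ⟨h2, u, hu, huy⟩
          · exact Or.inl (h2.trans hlr)
          · exact Or.inr ⟨h2, u, hu, hstep huy⟩
        · have h3 := hT y z hyz.1 hlr
          exact Or.inr ⟨⟨fold y, h3.1, h1⟩, fold z, h3.2, Relation.ReflTransGen.refl⟩
    rintro ⟨x, y⟩ hxy
    rcases key x y hxy with ⟨h1, h2 | ⟨⟨u, hu, hxu⟩, w, hw, hwy⟩⟩
    · exact Or.inl ⟨h2, h1⟩
    · exact Or.inr ⟨hs' _ _ (Or.inl hxu) hu, hs' _ _ (Or.inr hwy) hw⟩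

end DoubleRay

end CoarseStructure

theorem cellStructure_coloredLE (κ : DoubleKind) {R : CoarseStructure ℝ≥0} (hR : R.IsRay) (n : ℕ) :
    (cellStructure κ R n).ColoredLE (n + 1) :=
  AvoidLE.pi_prod_coloredLE (fun _ => doubleRay_avoidLE κ hR (n + 1)) (hR.avoidLE (n + 1))

/-! ### Attaching along a coarse retract -/

namespace CoarseStructure

variable {X Z W : Type*}

/-- The space `W` arises from `Z` by attaching `X` along a map defined on the image of a coarsely
uniform retraction `r` of `X`; `g` is the composition of `r` with the attaching map, `p` and `i` are
the canonical maps, and `ρ` is the induced retraction of `W` onto `Z`. -/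
structure IsRetractAttachment (EX : CoarseStructure X) (EZ : CoarseStructure Z)
    (EW : CoarseStructure W) (r : X → X) (g : X → Z) (p : X → W) (i : Z → W) (ρ : W → Z) :
    Prop where
  p_uniform : CoarselyUniform EX EW p
  i_uniform : CoarselyUniform EZ EW i
  r_uniform : CoarselyUniform EX EX r
  g_uniform : CoarselyUniform EX EZ g
  retract_p : ∀ x, ρ (p x) = g x
  retract_i : ∀ z, ρ (i z) = z
  p_retract : ∀ x, p (r x) = i (g x)
  cover : ∀ w, (∃ x, p x = w) ∨ ∃ z, i z = w
  p_inj : ∀ x x', p x = p x' → x = x' ∨ r x = x ∧ r x' = x'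
  p_eq_i : ∀ x z, p x = i z → r x = x
  minimal : ∀ C : CoarseStructure W, CoarselyUniform EX C p → CoarselyUniform EZ C i →
    EW.entourages ⊆ C.entourages

namespace IsRetractAttachment

variable {EX : CoarseStructure X} {EZ : CoarseStructure Z} {EW : CoarseStructure W} {r : X → X}
  {g : X → Z} {p : X → W} {i : Z → W} {ρ : W → Z}

theorem retract_uniform (H : IsRetractAttachment EX EZ EW r g p i ρ) : CoarselyUniform EW EZ ρ := by
  refine H.minimal (EZ.comap ρ) (fun M hM => ?_) (fun M hM => ?_) <;>
    rw [mem_comap, mapRel_mapRel]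
  · rw [show ρ ∘ p = g from funext H.retract_p]
    exact H.g_uniform M hM
  · rw [show ρ ∘ i = id from funext H.retract_i]
    exact CoarselyUniform.refl EZ M hM

/-- The points of the attached space that are close to the part `Z`. -/
def shallow (r : X → X) (p : X → W) (i : Z → W) (N : SetRel X X) : Set W :=
  {w | (∃ z, i z = w) ∨ ∃ x, p x = w ∧ (x, r x) ∈ N}

theorem shallow_mono {N N' : SetRel X X} (h : N ⊆ N') : shallow r p i N ⊆ shallow r p i N' := by
  rintro w (hw | ⟨x, hx, hN⟩)
  exacts [Or.inl hw, Or.inr ⟨x, hx, h hN⟩]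

/-- A point of `W` that lies in `Z` or has several preimages comes from fixed points of `r`, which
satisfy the condition for every reflexive `N`. So shallowness does not depend on the preimage. -/
theorem mem_of_mem_shallow (H : IsRetractAttachment EX EZ EW r g p i ρ) {N : SetRel X X}
    (hN : ∀ x, (x, x) ∈ N) {x : X} (h : p x ∈ shallow r p i N) : (x, r x) ∈ N := by
  rcases h with ⟨z, hz⟩ | ⟨x', hx', hN'⟩
  · rw [H.p_eq_i x z hz.symm]
    exact hN x
  · rcases H.p_inj _ _ hx' with rfl | ⟨-, h⟩
    · exact hN'
    · rw [h]
      exact hN x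

/-- An explicit description of the coarse structure of an attached space. -/
def explicit (H : IsRetractAttachment EX EZ EW r g p i ρ) : CoarseStructure W where
  -- On shallow pairs only the retraction is controlled. Nothing is lost, since shallow points are
  -- uniformly close to their retractions.
  entourages := {L | mapRel ρ L ∈ EZ.entourages ∧ ∃ N ∈ EX.entourages, ∀ w w', (w, w') ∈ L →
    (w ∈ shallow r p i N ∧ w' ∈ shallow r p i N) ∨ (w, w') ∈ mapRel p N}
  subset_mem := by
    rintro M L ⟨hL, N, hN, h⟩ hML
    exact ⟨(EZ.comap ρ).subset_mem hL hML, N, hN, fun w w' hw => h w w' (hML hw)⟩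
  union_mem := by
    rintro L L' ⟨hL, N, hN, h⟩ ⟨hL', N', hN', h'⟩
    refine ⟨(EZ.comap ρ).union_mem hL hL', N ∪ N', EX.union_mem hN hN', ?_⟩
    rintro w w' (hw | hw)
    · exact (h w w' hw).imp
        (And.imp (fun h => shallow_mono Set.subset_union_left h)
          fun h => shallow_mono Set.subset_union_left h)
        fun h => mapRel_mono p Set.subset_union_left h
    · exact (h' w w' hw).imp
        (And.imp (fun h => shallow_mono Set.subset_union_right h)
          fun h => shallow_mono Set.subset_union_right h)
        fun h => mapRel_mono p Set.subset_union_right h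
  diag_mem := by
    refine ⟨(EZ.comap ρ).diag_mem, SetRel.id, EX.diag_mem, ?_⟩
    rintro w w' hw
    obtain rfl : w = w' := hw
    rcases H.cover w with ⟨x, rfl⟩ | hz
    · exact Or.inr (mk_mem_mapRel p rfl)
    · exact Or.inl ⟨Or.inl hz, Or.inl hz⟩
  inv_mem := by
    rintro L ⟨hL, N, hN, h⟩
    refine ⟨(EZ.comap ρ).inv_mem hL, N ∪ N.inv, EX.union_mem hN (EX.inv_mem hN), ?_⟩
    rintro w w' hw
    rcases h w' w hw with ⟨h1, h2⟩ | h1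
    · exact Or.inl ⟨shallow_mono Set.subset_union_left h2, shallow_mono Set.subset_union_left h1⟩
    · obtain ⟨x, y, hxy, rfl, rfl⟩ := mem_mapRel.1 h1
      exact Or.inr (mk_mem_mapRel p (Or.inr hxy))
  comp_mem := by
    rintro L L' ⟨hL, N, hN, h⟩ ⟨hL', N', hN', h'⟩
    refine ⟨(EZ.comap ρ).comp_mem hL hL', ?_⟩
    obtain ⟨N₀, hN₀, hsub, hrefl, hsymm⟩ := exists_symm (EX.union_mem hN hN')
    have hs : ∀ {w}, w ∈ shallow r p i N ∨ w ∈ shallow r p i N' → w ∈ shallow r p i N₀ :=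
      fun hw => hw.elim (fun hw => shallow_mono (Set.subset_union_left.trans hsub) hw)
        fun hw => shallow_mono (Set.subset_union_right.trans hsub) hw
    -- A neighbour `x` of a shallow `x'` is shallow: pass from `x` to `x'`, to `r x'` and to `r x`,
    -- the last step being the image of the first under `r`.
    set N₂ := N₀.comp (N₀.comp (mapRel r N₀)) with hN₂
    have hdeep : ∀ {x x'}, (x, x') ∈ N₀ → (x', r x') ∈ N₀ → p x ∈ shallow r p i N₂ :=
      fun {x x'} h1 h2 => Or.inr ⟨x, rfl, x', h1, r x', h2, mk_mem_mapRel r (hsymm _ _ h1)⟩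
    refine ⟨N₀ ∪ N₂ ∪ N₀.comp N₀, EX.union_mem (EX.union_mem hN₀
      (EX.comp_mem hN₀ (EX.comp_mem hN₀ (H.r_uniform _ hN₀)))) (EX.comp_mem hN₀ hN₀), ?_⟩
    have hs0 : ∀ {w}, w ∈ shallow r p i N₀ → w ∈ shallow r p i (N₀ ∪ N₂ ∪ N₀.comp N₀) :=
      fun hw => shallow_mono (fun _ h => Or.inl (Or.inl h)) hw
    have hs2 : ∀ {w}, w ∈ shallow r p i N₂ → w ∈ shallow r p i (N₀ ∪ N₂ ∪ N₀.comp N₀) :=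
      fun hw => shallow_mono (fun _ h => Or.inl (Or.inr h)) hw
    rintro w w'' ⟨w', h1, h2⟩
    rcases h w w' h1 with ⟨a1, a2⟩ | a1 <;> rcases h' w' w'' h2 with ⟨b1, b2⟩ | b1
    · exact Or.inl ⟨hs0 (hs (Or.inl a1)), hs0 (hs (Or.inr b2))⟩
    · obtain ⟨x, y, hxy, rfl, rfl⟩ := mem_mapRel.1 b1
      exact Or.inl ⟨hs0 (hs (Or.inl a1)), hs2 (hdeep (hsymm _ _ (hsub (Or.inr hxy)))
        (H.mem_of_mem_shallow hrefl (hs (Or.inl a2))))⟩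
    · obtain ⟨x, y, hxy, rfl, rfl⟩ := mem_mapRel.1 a1
      exact Or.inl ⟨hs2 (hdeep (hsub (Or.inl hxy)) (H.mem_of_mem_shallow hrefl (hs (Or.inr b1)))),
        hs0 (hs (Or.inr b2))⟩
    · obtain ⟨x, y, hxy, rfl, rfl⟩ := mem_mapRel.1 a1
      obtain ⟨x', y', hxy', hx', rfl⟩ := mem_mapRel.1 b1
      rcases H.p_inj _ _ hx' with rfl | ⟨e1, e2⟩
      · exact Or.inr (mk_mem_mapRel p (Or.inr ⟨x', hsub (Or.inl hxy), hsub (Or.inr hxy')⟩))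
      -- Here `y` and `x'` may be different points that are glued, so the pairs need not compose in
      -- `X`. But both are fixed by `r`, hence the outer points are shallow.
      · refine Or.inl ⟨hs2 (hdeep (hsub (Or.inl hxy)) (by rw [e2]; exact hrefl _)),
          hs2 (hdeep (hsymm _ _ (hsub (Or.inr hxy'))) (by rw [e1]; exact hrefl _))⟩

theorem entourages_subset (H : IsRetractAttachment EX EZ EW r g p i ρ) :
    EW.entourages ⊆ H.explicit.entourages :=
  H.minimal H.explicit
    (fun M hM => ⟨H.retract_uniform _ (H.p_uniform M hM), M, hM, fun _ _ hw => Or.inr hw⟩)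
    fun M hM => ⟨H.retract_uniform _ (H.i_uniform M hM), SetRel.id, EX.diag_mem, by
      intro w w' hw
      obtain ⟨x, y, -, rfl, rfl⟩ := mem_mapRel.1 hw
      exact Or.inl ⟨Or.inl ⟨x, rfl⟩, Or.inl ⟨y, rfl⟩⟩⟩

/-- By `p_retract` a shallow point is uniformly close to its retraction, so one passes from `w` to
`i (ρ w)`, to `i (ρ w')` and to `w'`. -/
theorem shallow_mem (H : IsRetractAttachment EX EZ EW r g p i ρ) {N : SetRel X X}
    (hN : N ∈ EX.entourages) {K : SetRel Z Z} (hK : K ∈ EZ.entourages) :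
    ({q | q.1 ∈ shallow r p i N ∧ q.2 ∈ shallow r p i N ∧ (ρ q.1, ρ q.2) ∈ K} : SetRel W W) ∈
      EW.entourages := by
  have hD := EW.union_mem EW.diag_mem (H.p_uniform N hN)
  have key : ∀ w ∈ shallow r p i N, (w, i (ρ w)) ∈ SetRel.id ∪ mapRel p N := by
    rintro w (⟨z, rfl⟩ | ⟨x, rfl, hx⟩)
    · rw [H.retract_i]
      exact Or.inl rfl
    · rw [H.retract_p, ← H.p_retract]
      exact Or.inr (mk_mem_mapRel p hx)
  refine EW.subset_mem (EW.comp_mem hD (EW.comp_mem (H.i_uniform K hK) (EW.inv_mem hD))) ?_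
  rintro ⟨w, w'⟩ ⟨hw, hw', hK⟩
  exact ⟨i (ρ w), key w hw, i (ρ w'), mk_mem_mapRel i hK, key w' hw'⟩

/-- Off the shallow part `p` is injective and entourages come from `X`, so the colouring of `X`
works there. On the shallow part the colouring of `Z` is pulled back along `ρ`. The union argument
merges them with the same colours. -/
theorem coloredLE (H : IsRetractAttachment EX EZ EW r g p i ρ) {n : ℕ} (hX : EX.ColoredLE n)
    (hZ : EZ.ColoredLE n) : EW.ColoredLE n := by
  classical
  intro L hL
  obtain ⟨-, N₀, hN₀, hLN₀⟩ := H.entourages_subset hL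
  obtain ⟨N, hN, hN₀N, hrefl, -⟩ := exists_symm hN₀
  have hLN : ∀ w w', (w, w') ∈ L → w ∉ shallow r p i N → (w, w') ∈ mapRel p N := by
    intro w w' hw hw'
    rcases hLN₀ w w' hw with ⟨h, -⟩ | h
    · exact absurd (shallow_mono hN₀N h) hw'
    · exact mapRel_mono p hN₀N h
  obtain ⟨c, hc⟩ := hX N hN
  -- The default colour is immaterial: a point outside the image of `p` lies in the image of `i` and
  -- is shallow.
  let cB : W → Fin (n + 1) := fun w => if h : ∃ x, p x = w then c h.choose else 0
  have hinj : ∀ x x', p x = p x' → p x' ∉ shallow r p i N → x = x' := by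
    intro x x' hxx' hx'
    rcases H.p_inj x x' hxx' with h | ⟨-, h⟩
    · exact h
    · exact absurd (Or.inr ⟨x', rfl, h.symm ▸ hrefl x'⟩) hx'
  have hcB : ∀ x, p x ∉ shallow r p i N → cB (p x) = c x := by
    intro x hx
    have hex : ∃ x', p x' = p x := ⟨x, rfl⟩
    simp only [cB, dif_pos hex]
    rw [hinj _ _ hex.choose_spec hx]
  refine exists_coloring_union (shallow r p i N) hL cB ?_ fun L' hL' => ?_
  · refine EW.subset_mem (EW.union_mem EW.diag_mem (H.p_uniform _ hc)) ?_
    have key : ∀ w w', Relation.ReflTransGen (fun a b => (a, b) ∈ L ∧ a ∉ shallow r p i N ∧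
        b ∉ shallow r p i N ∧ cB a = cB b) w w' → w = w' ∨ ∃ x x', p x = w ∧ p x' = w' ∧
          (x, x') ∈ chains fun a b => (a, b) ∈ N ∧ c a = c b := by
      intro w w' hw
      induction hw with
      | refl => exact Or.inl rfl
      | @tail b d _ hbd ih =>
        obtain ⟨hbL, hb, hd, hcol⟩ := hbd
        obtain ⟨y, z, hyz, rfl, rfl⟩ := mem_mapRel.1 (hLN b d hbL hb)
        rw [hcB y hb, hcB z hd] at hcol
        rcases ih with rfl | ⟨x, x', rfl, hx', hch⟩
        · exact Or.inr ⟨y, z, rfl, rfl, Relation.ReflTransGen.single ⟨hyz, hcol⟩⟩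
        · obtain rfl := hinj _ _ hx' hb
          exact Or.inr ⟨x, z, rfl, rfl, Relation.ReflTransGen.tail hch ⟨hyz, hcol⟩⟩
    rintro ⟨w, w'⟩ hw
    rcases key w w' hw with h | ⟨x, x', rfl, rfl, h⟩
    · exact Or.inl h
    · exact Or.inr (mk_mem_mapRel p h)
  · obtain ⟨c', hc'⟩ := hZ _ (H.retract_uniform L' hL')
    refine ⟨fun w => c' (ρ w), EW.subset_mem (EW.union_mem EW.diag_mem (H.shallow_mem hN hc')) ?_⟩
    have hends : ∀ w w', Relation.ReflTransGen (fun a b => (a, b) ∈ L' ∧ a ∈ shallow r p i N ∧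
        b ∈ shallow r p i N ∧ c' (ρ a) = c' (ρ b)) w w' →
        w = w' ∨ w ∈ shallow r p i N ∧ w' ∈ shallow r p i N := by
      intro w w' hw
      induction hw with
      | refl => exact Or.inl rfl
      | tail _ hbd ih =>
        rcases ih with rfl | ⟨h, -⟩
        · exact Or.inr ⟨hbd.2.1, hbd.2.2.1⟩
        · exact Or.inr ⟨h, hbd.2.2.1⟩
    rintro ⟨w, w'⟩ hw
    rcases hends w w' hw with h | ⟨h1, h2⟩
    · exact Or.inl h
    · exact Or.inr ⟨h1, h2, mem_chains_map ρ
        (fun _ _ h => ⟨mk_mem_mapRel ρ h.1, h.2.2.2⟩) hw⟩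

end IsRetractAttachment

theorem coarselyUniform_prod_mk {F : Type*} {EX : CoarseStructure X} {EZ : CoarseStructure Z}
    {EF : CoarseStructure F} {f : F → X} {g : F → Z} (hf : CoarselyUniform EF EX f)
    (hg : CoarselyUniform EF EZ g) : CoarselyUniform EF (EX.prod EZ) fun x => (f x, g x) := by
  refine fun M hM => ⟨?_, ?_⟩
  · rw [mem_comap, mapRel_mapRel]
    exact hf M hM
  · rw [mem_comap, mapRel_mapRel]
    exact hg M hM

theorem coarselyUniform_fst {EX : CoarseStructure X} {EZ : CoarseStructure Z} :
    CoarselyUniform (EX.prod EZ) EX Prod.fst :=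
  fun _ hM => hM.1

theorem coarselyUniform_snd {EX : CoarseStructure X} {EZ : CoarseStructure Z} :
    CoarselyUniform (EX.prod EZ) EZ Prod.snd :=
  fun _ hM => hM.2

end CoarseStructure

/-! ### The upper bound for cell complexes -/

/-- The projection of a cell onto its boundary sphere. -/
def Cell.flatten {n : ℕ} (x : Cell n) : Cell n := (x.1, 0)

theorem Cell.flatten_uniform (κ : DoubleKind) (R : CoarseStructure ℝ≥0) (n : ℕ) :
    CoarselyUniform (cellStructure κ R n) (cellStructure κ R n) Cell.flatten :=
  coarselyUniform_prod_mk coarselyUniform_fst (CoarselyUniform.const 0)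

namespace CoarseCellComplex

variable {κ : DoubleKind} (C : CoarseCellComplex.{u, v} κ)

/-- The coarse structure on the disjoint union of the cells attached in step `k`. -/
def cells (k : ℕ) : CoarseStructure (Σ i : C.I k, Cell (C.n k i)) :=
  coprod fun i => cellStructure κ (C.R k i) (C.n k i)

/-- The projection of the disjoint union of the cells onto the disjoint union of the spheres. -/
def flatten (k : ℕ) (x : Σ i : C.I k, Cell (C.n k i)) : Σ i : C.I k, Cell (C.n k i) :=
  ⟨x.1, x.2.flatten⟩

/-- The composition of the projection of the cells onto the spheres and the attaching map. -/
def flatMap (k : ℕ) (x : Σ i : C.I (k + 1), Cell (C.n (k + 1) i)) : C.Y k :=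
  C.f k x.1 ⟨x.2.flatten, rfl⟩

/-- The characteristic map of the cells attached in step `k + 1`. -/
def cellMap (k : ℕ) (x : Σ i : C.I (k + 1), Cell (C.n (k + 1) i)) : C.Y (k + 1) :=
  (C.succEquiv k).symm (Quot.mk _ (Sum.inl x))

/-- The retraction of a stage onto the preceding one. -/
def retract (k : ℕ) (w : C.Y (k + 1)) : C.Y k :=
  Quot.lift (Sum.elim (C.flatMap k) id) (by
    rintro _ _ ⟨⟨⟨j, x, t⟩, h⟩⟩
    obtain rfl : t = 0 := h
    rfl) (C.succEquiv k w)

theorem flatten_uniform (k : ℕ) : CoarselyUniform (C.cells k) (C.cells k) (C.flatten k) :=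
  coarselyUniform_from_coprod fun i =>
    (coarselyUniform_sigmaMk _ i).comp (Cell.flatten_uniform _ _ _)

theorem flatMap_uniform (k : ℕ) : CoarselyUniform (C.cells (k + 1)) (C.E k) (C.flatMap k) := by
  refine coarselyUniform_from_coprod fun i => ?_
  have h : CoarselyUniform (cellStructure κ (C.R (k + 1) i) (C.n (k + 1) i))
      ((cellStructure κ (C.R (k + 1) i) (C.n (k + 1) i)).restrict (boundarySphere _))
      fun x => ⟨x.flatten, rfl⟩ := by
    intro M hM
    change mapRel _ _ ∈ (CoarseStructure.comap _ _).entourages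
    rw [mem_comap, mapRel_mapRel]
    exact Cell.flatten_uniform _ _ _ M hM
  exact (C.f_uniform k i).comp h

theorem quot_uniform (k : ℕ) : CoarselyUniform ((C.cells (k + 1)).sum (C.E k)) (C.E (k + 1))
    fun x => (C.succEquiv k).symm (Quot.mk _ x) := by
  intro M hM
  rw [C.succ_structure, mem_comap, mapRel_mapRel]
  refine mem_generate ⟨M, hM, ?_⟩
  congr 1
  funext x
  exact (Equiv.apply_symm_apply (C.succEquiv k) (Quot.mk _ x)).symm

open Classical in
theorem isRetractAttachment (k : ℕ) : IsRetractAttachment (C.cells (k + 1)) (C.E k) (C.E (k + 1))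
    (C.flatten (k + 1)) (C.flatMap k) (C.cellMap k) (C.incl k) (C.retract k) where
  p_uniform := (C.quot_uniform k).comp coarselyUniform_inl
  i_uniform := (C.quot_uniform k).comp coarselyUniform_inr
  r_uniform := C.flatten_uniform _
  g_uniform := C.flatMap_uniform k
  retract_p x := congrArg (Quot.lift (Sum.elim (C.flatMap k) id) _)
    (Equiv.apply_symm_apply (C.succEquiv k) (Quot.mk _ (Sum.inl x)))
  retract_i z := congrArg (Quot.lift (Sum.elim (C.flatMap k) id) _)
    (Equiv.apply_symm_apply (C.succEquiv k) (Quot.mk _ (Sum.inr z)))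
  p_retract x := by
    refine congrArg (C.succEquiv k).symm (Quot.sound ?_)
    exact AttachRel.glue (f := jointMap (C.f k)) ⟨C.flatten (k + 1) x, rfl⟩
  cover w := by
    obtain ⟨w, rfl⟩ := (C.succEquiv k).symm.surjective w
    obtain ⟨x | z, rfl⟩ := Quot.exists_rep w
    exacts [Or.inl ⟨x, rfl⟩, Or.inr ⟨z, rfl⟩]
  p_inj x x' h := by
    -- Points of the quotient are told apart by a function that respects the gluing: it remembers a
    -- point off the spheres and sends everything else to `none`.
    let e : Attach (jointMap (C.f k)) → Option (Σ i : C.I (k + 1), Cell (C.n (k + 1) i)) :=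
      Quot.lift (Sum.elim (fun x => if C.flatten (k + 1) x = x then none else some x)
        fun _ => none) (by
          rintro _ _ ⟨⟨⟨j, x, t⟩, h⟩⟩
          obtain rfl : t = 0 := h
          exact if_pos rfl)
    have h' : e (Quot.mk _ (Sum.inl x)) = e (Quot.mk _ (Sum.inl x')) :=
      congrArg e ((C.succEquiv k).symm.injective h)
    simp only [e, Sum.elim_inl] at h'
    split_ifs at h' with h1 h2 h2
    · exact Or.inr ⟨h1, h2⟩
    · exact Or.inl (Option.some.inj h')
  p_eq_i x z h := by
    let e : Attach (jointMap (C.f k)) → Prop :=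
      Quot.lift (Sum.elim (fun x => C.flatten (k + 1) x = x) fun _ => True) (by
          rintro _ _ ⟨⟨⟨j, x, t⟩, h⟩⟩
          obtain rfl : t = 0 := h
          exact eq_true rfl)
    have h' : e (Quot.mk _ (Sum.inl x)) = e (Quot.mk _ (Sum.inr z)) :=
      congrArg e ((C.succEquiv k).symm.injective h)
    exact of_eq_true h'
  minimal D hp hi := by
    intro M hM
    rw [C.succ_structure] at hM
    have h1 : ((C.cells (k + 1)).sum (C.E k)).entourages ⊆
        (D.comap fun x => (C.succEquiv k).symm (Quot.mk _ x)).entourages := by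
      refine sum_subset (fun N hN => ?_) (fun N hN => ?_) <;>
        rw [mem_comap, mapRel_mapRel]
      exacts [hp N hN, hi N hN]
    have h2 : mapRel (C.succEquiv k) M ∈ (D.comap (C.succEquiv k).symm).entourages := by
      refine generate_subset ?_ (mem_comap.1 hM)
      rintro _ ⟨N, hN, rfl⟩
      exact Eq.mpr (congrArg (· ∈ D.entourages) (mapRel_mapRel (Y := Attach (jointMap (C.f k)))
        (C.succEquiv k).symm (Quot.mk _) N)) (h1 hN)
    rw [mem_comap, mapRel_mapRel] at h2
    rwa [Equiv.symm_comp_self, mapRel_id] at h2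

theorem stage_coloredLE {N : ℕ} (hN : ∀ k i, C.n k i ≤ N) (k : ℕ) :
    (C.E k).ColoredLE (N + 1) := by
  have hcells : ∀ k, (C.cells k).ColoredLE (N + 1) := fun k => ColoredLE.coprod fun i =>
    (cellStructure_coloredLE κ (C.isRay k i) (C.n k i)).mono (by have := hN k i; omega)
  induction k with
  | zero =>
    intro L hL
    rw [C.zero_structure] at hL ⊢
    obtain ⟨c, hc⟩ := hcells 0 _ hL
    refine ⟨fun y => c (C.zeroEquiv y), (C.cells 0).subset_mem hc ?_⟩
    refine mapRel_subset fun x y hxy => mem_chains_map C.zeroEquiv ?_ hxy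
    exact fun x y h => ⟨mk_mem_mapRel _ h.1, h.2⟩
  | succ k ih => exact (C.isRetractAttachment k).coloredLE (hcells _) ih

/-- The retraction of a stage onto an earlier one. -/
def retractFrom (k l : ℕ) (h : k ≤ l) : C.Y l → C.Y k :=
  Nat.leRecOn (C := fun l => C.Y l → C.Y k) h (fun {_} g => g ∘ C.retract _) id

/-- The canonical map of a stage into a later one. -/
def inclTo (l k : ℕ) (h : l ≤ k) : C.Y l → C.Y k :=
  Nat.leRecOn (C := C.Y) h (fun {_} => C.incl _)

open Classical in
/-- The map of a stage to the stage `k` induced by the retractions and inclusions. -/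
def toStage (k l : ℕ) : C.Y l → C.Y k :=
  if h : l ≤ k then C.inclTo l k h else C.retractFrom k l (by omega)

theorem toStage_self (k : ℕ) (y : C.Y k) : C.toStage k k y = y := by
  simp [toStage, inclTo, Nat.leRecOn_self]

/-- Retractions undo inclusions, so the maps to stage `k` respect the identifications of the limit;
this is what lets `spaceRetract` be defined. -/
theorem toStage_incl (k l : ℕ) (y : C.Y l) : C.toStage k (l + 1) (C.incl l y) = C.toStage k l y := by
  unfold toStage
  by_cases h : l + 1 ≤ k
  · rw [dif_pos h, dif_pos (by omega)]
    unfold inclTo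
    rw [Nat.leRecOn_succ_left]
  · rw [dif_neg h]
    have hstep : C.retractFrom k (l + 1) (by omega) = C.retractFrom k l (by omega) ∘ C.retract l := by
      unfold retractFrom
      rw [Nat.leRecOn_succ]
    rw [hstep, Function.comp_apply, (C.isRetractAttachment l).retract_i]
    by_cases h' : l ≤ k
    · obtain rfl : l = k := by omega
      rw [dif_pos le_rfl]
      simp [retractFrom, inclTo, Nat.leRecOn_self]
    · rw [dif_neg h']

theorem inclTo_uniform (l k : ℕ) (h : l ≤ k) : CoarselyUniform (C.E l) (C.E k) (C.inclTo l k h) := by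
  induction k, h using Nat.le_induction with
  | base =>
    convert CoarselyUniform.refl (C.E l)
    funext y
    simp [inclTo, Nat.leRecOn_self]
  | succ k h ih =>
    convert (C.isRetractAttachment k).i_uniform.comp ih
    funext y
    simp [inclTo, Nat.leRecOn_succ h]

theorem retractFrom_uniform (k l : ℕ) (h : k ≤ l) :
    CoarselyUniform (C.E l) (C.E k) (C.retractFrom k l h) := by
  induction l, h using Nat.le_induction with
  | base =>
    convert CoarselyUniform.refl (C.E k)
    simp [retractFrom, Nat.leRecOn_self]
  | succ l h ih =>
    convert ih.comp (C.isRetractAttachment l).retract_uniform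
    unfold retractFrom
    rw [Nat.leRecOn_succ]

theorem toStage_uniform (k l : ℕ) : CoarselyUniform (C.E l) (C.E k) (C.toStage k l) := by
  unfold toStage
  split_ifs
  exacts [C.inclTo_uniform _ _ _, C.retractFrom_uniform _ _ _]

/-- The retraction of the complex onto one of its stages. -/
def spaceRetract (k : ℕ) : C.Space → C.Y k :=
  Quot.lift (fun x => C.toStage k x.1 x.2) (by
    rintro _ _ ⟨l, y⟩
    exact (C.toStage_incl k l y).symm)

theorem spaceRetract_toSpace (k : ℕ) (y : C.Y k) : C.spaceRetract k (C.toSpace k y) = y :=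
  C.toStage_self k y

theorem toSpace_uniform (k : ℕ) : CoarselyUniform (C.E k) C.coarseStructure (C.toSpace k) :=
  coarselyUniform_to_final k

theorem spaceRetract_uniform (k : ℕ) :
    CoarselyUniform C.coarseStructure (C.E k) (C.spaceRetract k) :=
  coarselyUniform_from_final fun l => C.toStage_uniform k l

/-- The relations of this form are themselves a coarse structure: two of them can be moved to a
common stage, and they compose there because stages inject into the limit. -/
theorem exists_of_mem {L : SetRel C.Space C.Space} (hL : L ∈ C.coarseStructure.entourages) :
    ∃ k, ∃ M ∈ (C.E k).entourages, L ⊆ SetRel.id ∪ mapRel (C.toSpace k) M := by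
  have hup : ∀ k l, k ≤ l → ∀ M ∈ (C.E k).entourages, ∃ M' ∈ (C.E l).entourages,
      mapRel (C.toSpace k) M ⊆ mapRel (C.toSpace l) M' := by
    intro k l h
    induction l, h using Nat.le_induction with
    | base => exact fun M hM => ⟨M, hM, subset_rfl⟩
    | succ l h ih =>
      intro M hM
      obtain ⟨M', hM', hsub⟩ := ih M hM
      refine ⟨_, (C.isRetractAttachment l).i_uniform _ hM', hsub.trans ?_⟩
      rw [mapRel_mapRel]
      refine mapRel_subset fun x y hxy => mem_mapRel.2 ⟨x, y, hxy, ?_, ?_⟩ <;>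
        exact (Quot.sound (LimRel.step l _)).symm
  have hinj : ∀ k, Function.Injective (C.toSpace k) := fun k =>
    Function.LeftInverse.injective (C.spaceRetract_toSpace k)
  have hjoin : ∀ {L L' : SetRel C.Space C.Space},
      (∃ k, ∃ M ∈ (C.E k).entourages, L ⊆ SetRel.id ∪ mapRel (C.toSpace k) M) →
      (∃ k, ∃ M ∈ (C.E k).entourages, L' ⊆ SetRel.id ∪ mapRel (C.toSpace k) M) →
      ∃ k, ∃ M ∈ (C.E k).entourages, ∃ M' ∈ (C.E k).entourages,
        L ⊆ SetRel.id ∪ mapRel (C.toSpace k) M ∧ L' ⊆ SetRel.id ∪ mapRel (C.toSpace k) M' := by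
    rintro L L' ⟨k, M, hM, hL⟩ ⟨k', M', hM', hL'⟩
    obtain ⟨N, hN, hMN⟩ := hup k (max k k') (le_max_left _ _) M hM
    obtain ⟨N', hN', hMN'⟩ := hup k' (max k k') (le_max_right _ _) M' hM'
    exact ⟨max k k', N, hN, N', hN', hL.trans (Set.union_subset_union_right _ hMN),
      hL'.trans (Set.union_subset_union_right _ hMN')⟩
  let D : CoarseStructure C.Space :=
    { entourages := {L | ∃ k, ∃ M ∈ (C.E k).entourages, L ⊆ SetRel.id ∪ mapRel (C.toSpace k) M}
      subset_mem := fun ⟨k, M, hM, hL⟩ h => ⟨k, M, hM, h.trans hL⟩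
      union_mem := by
        intro L L' h h'
        obtain ⟨k, M, hM, M', hM', hL, hL'⟩ := hjoin h h'
        refine ⟨k, M ∪ M', (C.E k).union_mem hM hM', Set.union_subset (hL.trans ?_) (hL'.trans ?_)⟩
        · exact Set.union_subset_union_right _ (mapRel_mono _ Set.subset_union_left)
        · exact Set.union_subset_union_right _ (mapRel_mono _ Set.subset_union_right)
      diag_mem := ⟨0, ∅, (C.E 0).empty_mem, Set.subset_union_left⟩
      inv_mem := by
        rintro L ⟨k, M, hM, hL⟩
        refine ⟨k, M.inv, (C.E k).inv_mem hM, ?_⟩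
        rintro ⟨a, b⟩ hab
        rcases hL (a := (b, a)) hab with h | h
        · exact Or.inl (Eq.symm h)
        · obtain ⟨x, y, hxy, rfl, rfl⟩ := mem_mapRel.1 h
          exact Or.inr (mk_mem_mapRel _ hxy)
      comp_mem := by
        intro L L' h h'
        obtain ⟨k, M, hM, M', hM', hL, hL'⟩ := hjoin h h'
        refine ⟨k, M ∪ M' ∪ M.comp M', (C.E k).union_mem ((C.E k).union_mem hM hM')
          ((C.E k).comp_mem hM hM'), ?_⟩
        rintro ⟨a, d⟩ ⟨b, hab, hbd⟩
        rcases hL hab with h | h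
        · obtain rfl : a = b := h
          rcases hL' hbd with h | h
          · exact Or.inl h
          · exact Or.inr (mapRel_mono _ (fun _ h => Or.inl (Or.inr h)) h)
        · rcases hL' hbd with h' | h'
          · obtain rfl : b = d := h'
            exact Or.inr (mapRel_mono _ (fun _ h => Or.inl (Or.inl h)) h)
          · obtain ⟨x, y, hxy, rfl, rfl⟩ := mem_mapRel.1 h
            obtain ⟨x', y', hxy', hx', rfl⟩ := mem_mapRel.1 h'
            obtain rfl := hinj k hx'
            exact Or.inr (mk_mem_mapRel _ (Or.inr ⟨x', hxy, hxy'⟩)) }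
  exact final_subset (C := D) (fun k M hM => ⟨k, M, hM, Set.subset_union_right⟩) hL

/-- A chain moves only by steps inside one stage and is constant outside it, so the colouring of
that stage, pulled back along the retraction, serves for the whole complex. -/
theorem coloredLE {N : ℕ} (hN : ∀ k i, C.n k i ≤ N) : C.coarseStructure.ColoredLE (N + 1) := by
  intro L hL
  obtain ⟨k, M, hM, hLM⟩ := C.exists_of_mem hL
  obtain ⟨c, hc⟩ := C.stage_coloredLE hN k M hM
  refine ⟨fun w => c (C.spaceRetract k w), C.coarseStructure.subset_mem
    (C.coarseStructure.union_mem C.coarseStructure.diag_mem (C.toSpace_uniform k _ hc)) ?_⟩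
  have key : ∀ w w', Relation.ReflTransGen
      (fun a b => (a, b) ∈ L ∧ c (C.spaceRetract k a) = c (C.spaceRetract k b)) w w' →
      w = w' ∨ ∃ x x', C.toSpace k x = w ∧ C.toSpace k x' = w' ∧
        (x, x') ∈ chains fun a b => (a, b) ∈ M ∧ c a = c b := by
    intro w w' hw
    induction hw with
    | refl => exact Or.inl rfl
    | @tail b d _ hbd ih =>
      rcases hLM hbd.1 with h | h
      · obtain rfl : b = d := h
        exact ih
      · obtain ⟨y, z, hyz, rfl, rfl⟩ := mem_mapRel.1 h
        have hcol := hbd.2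
        rw [C.spaceRetract_toSpace, C.spaceRetract_toSpace] at hcol
        rcases ih with rfl | ⟨x, x', rfl, hx', hch⟩
        · exact Or.inr ⟨y, z, rfl, rfl, Relation.ReflTransGen.single ⟨hyz, hcol⟩⟩
        · have hx := congrArg (C.spaceRetract k) hx'
          rw [C.spaceRetract_toSpace, C.spaceRetract_toSpace] at hx
          subst hx
          exact Or.inr ⟨x, z, rfl, rfl, Relation.ReflTransGen.tail hch ⟨hyz, hcol⟩⟩
  rintro ⟨w, w'⟩ hw
  rcases key w w' hw with h | ⟨x, x', rfl, rfl, h⟩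
  · exact Or.inl h
  · exact Or.inr (mk_mem_mapRel _ h)

end CoarseCellComplex

/-! ### Kuhn's cubical Sperner lemma -/

namespace Kuhn

variable {d N : ℕ}

/-- The simplices of Kuhn's triangulation of the grid, given by the least vertex and the
permutation that sends a coordinate to the step in which it increases. -/
abbrev Simplex (d : ℕ) : Type := (Fin d → ℕ) × Equiv.Perm (Fin d)

/-- The vertices of a simplex. -/
def vert (s : Simplex d) (m : ℕ) : Fin d → ℕ := fun i => s.1 i + if (s.2 i : ℕ) < m then 1 else 0

/-- The simplices that represent the `k`-simplices in the face of the grid where all the coordinates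
with index at least `k` vanish. -/
def faceSimplices (d N k : ℕ) : Finset (Simplex d) :=
  ((Fintype.piFinset fun _ => Finset.range N) ×ˢ Finset.univ).filter
    fun s => ∀ i : Fin d, k ≤ i → s.1 i = 0 ∧ s.2 i = i

theorem mem_faceSimplices {k : ℕ} {s : Simplex d} :
    s ∈ faceSimplices d N k ↔
      (∀ i, s.1 i < N) ∧ ∀ i : Fin d, k ≤ i → s.1 i = 0 ∧ s.2 i = i := by
  simp [faceSimplices]

/-- Labellings of the grid with the boundary behaviour required in Kuhn's lemma. -/
structure IsLabelling (N : ℕ) (ℓ : (Fin d → ℕ) → ℕ) : Prop where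
  le_dim : ∀ x, (∀ i, x i ≤ N) → ℓ x ≤ d
  le_of_eq_zero : ∀ x, (∀ i, x i ≤ N) → ∀ i : Fin d, x i = 0 → ℓ x ≤ i
  ne_of_eq : ∀ x, (∀ i, x i ≤ N) → ∀ i : Fin d, x i = N → ℓ x ≠ i

/-- The first `k + 1` vertices carry all the labels from `0` to `k`. -/
def IsRainbow (ℓ : (Fin d → ℕ) → ℕ) (k : ℕ) (s : Simplex d) : Prop :=
  ∀ l ≤ k, ∃ m ≤ k, ℓ (vert s m) = l

/-- The first `k + 2` vertices without the `m`-th one carry all the labels from `0` to `k`. -/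
def IsDoor (ℓ : (Fin d → ℕ) → ℕ) (k m : ℕ) (s : Simplex d) : Prop :=
  ∀ l ≤ k, ∃ m' ≤ k + 1, m' ≠ m ∧ ℓ (vert s m') = l

theorem vert_le {k : ℕ} {s : Simplex d} (hs : s ∈ faceSimplices d N k) (m : ℕ) (i : Fin d) :
    vert s m i ≤ N := by
  have := (mem_faceSimplices.1 hs).1 i
  unfold vert
  split_ifs <;> omega

open Classical in
-- If `g` takes all values, only the index with value `k + 1` can be omitted. Otherwise an index
-- that can be omitted shares its value with exactly one other, which can be omitted too; so the
-- count is `0` or `2`.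
theorem card_omit_parity {k : ℕ} {g : ℕ → ℕ} (hg : ∀ m ≤ k + 1, g m ≤ k + 1) :
    (((Finset.range (k + 2)).filter
      fun m => ∀ l ≤ k, ∃ m' ≤ k + 1, m' ≠ m ∧ g m' = l).card : ZMod 2) =
      if ∀ l ≤ k + 1, ∃ m ≤ k + 1, g m = l then 1 else 0 := by
  split_ifs with h
  · have hinj : Set.InjOn g (Finset.range (k + 2)) := by
      refine Finset.injOn_of_surjOn_of_card_le (t := Finset.range (k + 2)) g ?_ ?_ le_rfl
      · intro m hm
        have := hg m (by simp at hm; omega)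
        simp
        omega
      · intro l hl
        obtain ⟨m, hm, hml⟩ := h l (by simp at hl; omega)
        exact ⟨m, by simp; omega, hml⟩
    obtain ⟨m₀, hm₀, hgm₀⟩ := h (k + 1) le_rfl
    have : (Finset.range (k + 2)).filter
        (fun m => ∀ l ≤ k, ∃ m' ≤ k + 1, m' ≠ m ∧ g m' = l) = {m₀} := by
      ext m
      simp only [Finset.mem_filter, Finset.mem_range, Finset.mem_singleton]
      constructor
      · rintro ⟨hm, hdoor⟩
        by_contra hne
        have hgm : g m ≤ k := by
          have h1 := hg m (by omega)
          have h2 : g m ≠ k + 1 := fun h2 => hne (hinj (by simp; omega) (by simp; omega)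
            (h2.trans hgm₀.symm))
          omega
        obtain ⟨m', hm', hne', hgm'⟩ := hdoor (g m) hgm
        exact hne' (hinj (by simp; omega) (by simp; omega) hgm')
      · rintro rfl
        refine ⟨by omega, fun l hl => ?_⟩
        obtain ⟨m', hm', hgm'⟩ := h l (by omega)
        exact ⟨m', hm', by rintro rfl; omega, hgm'⟩
    rw [this]
    simp
  · by_cases hemp : (Finset.range (k + 2)).filter
        (fun m => ∀ l ≤ k, ∃ m' ≤ k + 1, m' ≠ m ∧ g m' = l) = ∅
    · rw [hemp]
      simp
    · obtain ⟨m₀, hm₀⟩ := Finset.nonempty_iff_ne_empty.2 hemp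
      simp only [Finset.mem_filter, Finset.mem_range] at hm₀
      obtain ⟨hm₀, hdoor⟩ := hm₀
      have hsurj : ∀ l ≤ k, ∃ m' ≤ k + 1, m' ≠ m₀ ∧ g m' = l := hdoor
      have hgm₀ : g m₀ ≤ k := by
        have h1 := hg m₀ (by omega)
        have h2 : g m₀ ≠ k + 1 := by
          intro h2
          refine h fun l hl => ?_
          rcases Nat.lt_or_ge k l with hlk | hlk
          · exact ⟨m₀, by omega, by omega⟩
          · obtain ⟨m', h3, -, h4⟩ := hsurj l hlk
            exact ⟨m', h3, h4⟩
        omega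
      have hcard : ((Finset.range (k + 2)).erase m₀).card = k + 1 := by
        rw [Finset.card_erase_of_mem (by simpa using hm₀)]
        simp
      have himg : Finset.range (k + 1) ⊆ ((Finset.range (k + 2)).erase m₀).image g := by
        intro l hl
        obtain ⟨m', h3, h4, h5⟩ := hsurj l (by simp at hl; omega)
        exact Finset.mem_image.2 ⟨m', by simp; omega, h5⟩
      have heq : Finset.range (k + 1) = ((Finset.range (k + 2)).erase m₀).image g := by
        refine Finset.eq_of_subset_of_card_le himg (Finset.card_image_le.trans ?_)
        rw [hcard, Finset.card_range]
      have hinj : Set.InjOn g ((Finset.range (k + 2)).erase m₀) := by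
        refine Finset.card_image_iff.1 ?_
        rw [← heq, hcard, Finset.card_range]
      obtain ⟨m₁, hm₁, hne, hgm⟩ := hsurj (g m₀) hgm₀
      have hle : ∀ m ≤ k + 1, g m ≤ k := by
        intro m hm
        by_cases hmm : m = m₀
        · rwa [hmm]
        · have : g m ∈ Finset.range (k + 1) := by
            rw [heq]
            exact Finset.mem_image.2 ⟨m, by simp; omega, rfl⟩
          simp at this
          omega
      have : (Finset.range (k + 2)).filter
          (fun m => ∀ l ≤ k, ∃ m' ≤ k + 1, m' ≠ m ∧ g m' = l) = {m₀, m₁} := by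
        ext m
        simp only [Finset.mem_filter, Finset.mem_range, Finset.mem_insert, Finset.mem_singleton]
        constructor
        · rintro ⟨hm, hd⟩
          by_contra! hcon
          obtain ⟨m', h1, h2, h3⟩ := hd (g m) (hle m (by omega))
          by_cases h4 : m' = m₀
          · rw [h4, ← hgm] at h3
            exact hcon.2 (hinj (by simp; omega) (by simp; omega) h3.symm)
          · exact h2 (hinj (by simp; omega) (by simp; omega) h3)
        · rintro (rfl | rfl)
          · exact ⟨hm₀, hdoor⟩
          · refine ⟨by omega, fun l hl => ?_⟩
            obtain ⟨m', h1, h2, h3⟩ := hsurj l hl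
            by_cases h4 : m' = m
            · exact ⟨m₀, by omega, hne.symm, by rw [← hgm, ← h4, h3]⟩
            · exact ⟨m', h1, h4, h3⟩
      rw [this, Finset.card_pair hne.symm]
      rfl

variable {ℓ : (Fin d → ℕ) → ℕ} {k : ℕ}

/-- Exchanging two consecutive steps changes only one vertex. -/
theorem vert_swap (s : Simplex d) {m : ℕ} (hm : m + 1 < d) {m' : ℕ} (h : m' ≠ m + 1) :
    vert (s.1, Equiv.swap ⟨m, by omega⟩ ⟨m + 1, hm⟩ * s.2) m' = vert s m' := by
  funext i
  simp only [vert, Equiv.Perm.mul_apply]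
  congr 2
  rw [Equiv.swap_apply_def]
  split_ifs with h1 h2
  · rw [h1]
    simp only [eq_iff_iff]
    omega
  · rw [h2]
    simp only [eq_iff_iff]
    omega
  · rfl

open Classical in
-- Exchanging the steps `m` and `m + 1` moves only the vertex `m + 1` and so keeps the opposite
-- facet. This involution without fixed points pairs the doors off.
theorem sum_inner_doors {m : ℕ} (hmk : m < k) (hk : k < d) :
    ∑ s ∈ faceSimplices d N (k + 1), (if IsDoor ℓ k (m + 1) s then 1 else 0 : ZMod 2) = 0 := by
  have hm : m + 1 < d := by omega
  have hne : (⟨m, by omega⟩ : Fin d) ≠ ⟨m + 1, hm⟩ := by simp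
  refine Finset.sum_involution
    (fun s _ => (s.1, Equiv.swap ⟨m, by omega⟩ ⟨m + 1, hm⟩ * s.2)) ?_ ?_ ?_ ?_
  · intro s _
    have : IsDoor ℓ k (m + 1) (s.1, Equiv.swap ⟨m, by omega⟩ ⟨m + 1, hm⟩ * s.2) ↔
        IsDoor ℓ k (m + 1) s := by
      refine forall₂_congr fun l _ => exists_congr fun m' => and_congr_right fun _ =>
        and_congr_right fun h => ?_
      rw [vert_swap s hm h]
    simp only [this]
    split_ifs
    · rfl
    · rfl
  · intro s _ _ h
    have h1 := mul_eq_right.1 (congrArg Prod.snd h)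
    exact hne (Equiv.swap_eq_one_iff.1 h1)
  · intro s hs
    obtain ⟨h1, h2⟩ := mem_faceSimplices.1 hs
    refine mem_faceSimplices.2 ⟨h1, fun i hi => ⟨(h2 i hi).1, ?_⟩⟩
    rw [Equiv.Perm.mul_apply, (h2 i hi).2]
    refine Equiv.swap_apply_of_ne_of_ne (fun h => ?_) (fun h => ?_) <;>
      · rw [h] at hi
        simp only at hi
        omega
  · intro s _
    simp

theorem cycleRange_val (c x : Fin d) :
    (c.cycleRange x : ℕ) = if (x : ℕ) < c then (x : ℕ) + 1 else if (x : ℕ) = c then 0 else x := by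
  split_ifs with h1 h2
  · exact Fin.coe_cycleRange_of_lt h1
  · rw [Fin.coe_cycleRange_of_le (le_of_eq (Fin.ext h2)), if_pos (Fin.ext h2)]
  · rw [Fin.cycleRange_of_gt]
    exact Fin.lt_def.2 (by omega)

theorem cycleRange_symm_val (c y : Fin d) :
    (c.cycleRange.symm y : ℕ) = if (y : ℕ) = 0 then (c : ℕ) else
      if (y : ℕ) ≤ c then (y : ℕ) - 1 else y := by
  obtain ⟨x, rfl⟩ := c.cycleRange.surjective y
  have h := cycleRange_val c x
  rw [Equiv.symm_apply_apply]
  split_ifs at h ⊢ <;> omega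

/-- Passing to the simplex on the other side of the facet opposite to the least vertex. -/
def rot (c : Fin d) (s : Simplex d) : Simplex d :=
  (fun i => s.1 i + if (s.2 i : ℕ) = 0 then 1 else 0, c.cycleRange.symm * s.2)

/-- The inverse of `rot`. -/
def unrot (c : Fin d) (s : Simplex d) : Simplex d :=
  (fun i => s.1 i - if (s.2 i : ℕ) = c then 1 else 0, c.cycleRange * s.2)

theorem unrot_rot (c : Fin d) (s : Simplex d) : unrot c (rot c s) = s := by
  refine Prod.ext (funext fun i => ?_) ?_
  · simp only [unrot, rot, Equiv.Perm.mul_apply, cycleRange_symm_val]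
    split_ifs <;> omega
  · refine Equiv.ext fun i => ?_
    simp [unrot, rot]

theorem rot_unrot (c : Fin d) (s : Simplex d) (h : ∀ i, s.2 i = c → 1 ≤ s.1 i) :
    rot c (unrot c s) = s := by
  refine Prod.ext (funext fun i => ?_) ?_
  · have := h i
    have hc := cycleRange_val c (s.2 i)
    simp only [Fin.ext_iff] at this
    have hc0 : (((unrot c s).2 i : Fin d) : ℕ) = 0 ↔ (s.2 i : ℕ) = c := by
      change (c.cycleRange (s.2 i) : ℕ) = 0 ↔ _
      split_ifs at hc <;> omega
    have hif : (if ((unrot c s).2 i : ℕ) = 0 then 1 else 0) = if (s.2 i : ℕ) = c then 1 else 0 :=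
      if_congr hc0 rfl rfl
    change (s.1 i - if (s.2 i : ℕ) = c then 1 else 0) +
      (if ((unrot c s).2 i : ℕ) = 0 then 1 else 0) = s.1 i
    rw [hif]
    split_ifs <;> omega
  · refine Equiv.ext fun i => ?_
    simp [unrot, rot]

theorem vert_rot {c : Fin d} (s : Simplex d) {m : ℕ} (hm : m ≤ c) :
    vert (rot c s) m = vert s (m + 1) := by
  funext i
  simp only [vert, rot, Equiv.Perm.mul_apply, cycleRange_symm_val]
  split_ifs <;> omega

/-- A door opposite to the least vertex is also a facet of the neighbouring simplex, where it is
opposite to the last vertex; the boundary labels keep that neighbour inside the grid. -/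
theorem rot_mem (hℓ : IsLabelling N ℓ) {c : Fin d} {s : Simplex d}
    (hs : s ∈ faceSimplices d N (c + 1)) (hdoor : IsDoor ℓ c 0 s) :
    rot c s ∈ faceSimplices d N (c + 1) ∧ IsDoor ℓ c (c + 1) (rot c s) ∧
      rot c s ∉ faceSimplices d N c := by
  obtain ⟨h1, h2⟩ := mem_faceSimplices.1 hs
  refine ⟨mem_faceSimplices.2 ⟨fun i => ?_, fun i hi => ?_⟩, fun l hl => ?_, fun hmem => ?_⟩
  · have hi1 := h1 i
    simp only [rot]
    split_ifs with hi
    -- If the move left the grid, the whole facet would have `i`-th coordinate `N`, and the label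
    -- `i` could not occur on it.
    · by_contra hcon
      have hic : (i : ℕ) ≤ c := by
        by_contra hcon
        have := (h2 i (by omega)).2
        rw [this] at hi
        omega
      obtain ⟨m, -, hm, hl⟩ := hdoor i hic
      refine hℓ.ne_of_eq _ (vert_le hs m) i ?_ hl
      unfold vert
      rw [if_pos (by omega)]
      omega
    · exact hi1
  · obtain ⟨h3, h4⟩ := h2 i hi
    refine ⟨?_, Fin.ext ?_⟩
    · simp only [rot, h3, h4]
      rw [if_neg (by omega)]
    · simp only [rot, Equiv.Perm.mul_apply, cycleRange_symm_val, h4]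
      split_ifs <;> omega
  · obtain ⟨m, hm, hm0, hml⟩ := hdoor l hl
    refine ⟨m - 1, by omega, by omega, ?_⟩
    rw [vert_rot s (by omega), Nat.sub_add_cancel (by omega), hml]
  · obtain ⟨h3, h4⟩ := (mem_faceSimplices.1 hmem).2 c le_rfl
    have h5 := congrArg Fin.val h4
    simp only [rot, Equiv.Perm.mul_apply, cycleRange_symm_val] at h3 h5
    split_ifs at h3 h5 <;> omega

/-- If `s.1 i` were `0`, the coordinate `i` would vanish on the vertices `0, …, c` and force their
labels to be at most `i`. As the label `c` occurs, this gives `i = c` and puts `s` in the lower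
face. Thus the subtraction in `unrot` is not truncated. -/
theorem pos_of_not_mem (hℓ : IsLabelling N ℓ) {c : Fin d} {s : Simplex d}
    (hs : s ∈ faceSimplices d N (c + 1)) (hdoor : IsDoor ℓ c (c + 1) s)
    (hs' : s ∉ faceSimplices d N c) (i : Fin d) (hi : s.2 i = c) : 1 ≤ s.1 i := by
  obtain ⟨h1, h2⟩ := mem_faceSimplices.1 hs
  by_contra hcon
  obtain ⟨m, hm, hmc, hml⟩ := hdoor c le_rfl
  have hle : ℓ (vert s m) ≤ i := by
    refine hℓ.le_of_eq_zero _ (vert_le hs m) i ?_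
    unfold vert
    rw [hi, if_neg (by omega)]
    omega
  have hic : i = c := by
    by_contra hne
    have := (h2 i (by have := Fin.val_ne_of_ne hne; omega)).2
    exact hne (this.symm.trans hi)
  subst hic
  refine hs' (mem_faceSimplices.2 ⟨h1, fun j hj => ?_⟩)
  by_cases hji : j = i
  · subst hji
    exact ⟨by omega, hi⟩
  · exact h2 j (by have := Fin.val_ne_of_ne hji; omega)

theorem unrot_mem (hℓ : IsLabelling N ℓ) {c : Fin d} {s : Simplex d}
    (hs : s ∈ faceSimplices d N (c + 1)) (hdoor : IsDoor ℓ c (c + 1) s)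
    (hs' : s ∉ faceSimplices d N c) :
    unrot c s ∈ faceSimplices d N (c + 1) ∧ IsDoor ℓ c 0 (unrot c s) := by
  obtain ⟨h1, h2⟩ := mem_faceSimplices.1 hs
  have hmem : unrot c s ∈ faceSimplices d N (c + 1) := by
    refine mem_faceSimplices.2 ⟨fun i => (Nat.sub_le _ _).trans_lt (h1 i), fun i hi => ?_⟩
    obtain ⟨h3, h4⟩ := h2 i hi
    refine ⟨?_, Fin.ext ?_⟩
    · simp [unrot, h3]
    · simp only [unrot, Equiv.Perm.mul_apply, cycleRange_val, h4]
      split_ifs <;> omega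
  refine ⟨hmem, fun l hl => ?_⟩
  obtain ⟨m, hm, hmc, hml⟩ := hdoor l hl
  refine ⟨m + 1, by omega, by omega, ?_⟩
  rw [← vert_rot (c := c) (unrot c s) (by omega),
    rot_unrot c s (pos_of_not_mem hℓ hs hdoor hs'), hml]

open Classical in
-- Modulo `2`, rainbow simplices are counted by their doors. Doors on inner facets cancel. By `rot`,
-- doors opposite to the least vertex match doors opposite to the last one, except those of
-- simplices in `faceSimplices d N k`, which are the rainbow simplices one dimension lower.
theorem rainbow_parity_succ (hℓ : IsLabelling N ℓ) (hk : k < d) :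
    (((faceSimplices d N (k + 1)).filter (IsRainbow ℓ (k + 1))).card : ZMod 2) =
      ((faceSimplices d N k).filter (IsRainbow ℓ k)).card := by
  have hle : ∀ s ∈ faceSimplices d N (k + 1), ∀ m ≤ k + 1, ℓ (vert s m) ≤ k + 1 := by
    intro s hs m hm
    rcases Nat.lt_or_ge (k + 1) d with h | h
    · refine hℓ.le_of_eq_zero _ (vert_le hs m) ⟨k + 1, h⟩ ?_
      obtain ⟨h3, h4⟩ := (mem_faceSimplices.1 hs).2 ⟨k + 1, h⟩ le_rfl
      simp only [vert, h3, h4]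
      rw [if_neg (by omega)]
    · exact (hℓ.le_dim _ (vert_le hs m)).trans h
  have hcount : (((faceSimplices d N (k + 1)).filter (IsRainbow ℓ (k + 1))).card : ZMod 2) =
      ∑ m ∈ Finset.range (k + 2), ∑ s ∈ faceSimplices d N (k + 1),
        (if IsDoor ℓ k m s then 1 else 0 : ZMod 2) := by
    rw [Finset.sum_comm, Finset.card_filter, Nat.cast_sum]
    refine Finset.sum_congr rfl fun s hs => ?_
    rw [← Finset.natCast_card_filter]
    rw [Nat.cast_ite, Nat.cast_one, Nat.cast_zero]
    convert (card_omit_parity (hle s hs)).symm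
    exacts [Iff.rfl, Iff.rfl]
  rw [hcount, Finset.sum_range_succ, Finset.sum_range_succ',
    Finset.sum_eq_zero fun m hm => sum_inner_doors (Finset.mem_range.1 hm) hk, zero_add,
    ← Finset.natCast_card_filter, ← Finset.natCast_card_filter,
    ← Finset.card_filter_add_card_filter_not (s := (faceSimplices d N (k + 1)).filter
      (IsDoor ℓ k (k + 1))) (fun s => s ∈ faceSimplices d N k)]
  have hfirst : ((faceSimplices d N (k + 1)).filter (IsDoor ℓ k (k + 1))).filter
      (fun s => s ∈ faceSimplices d N k) = (faceSimplices d N k).filter (IsRainbow ℓ k) := by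
    ext s
    have hiff : IsDoor ℓ k (k + 1) s ↔ IsRainbow ℓ k s := by
      refine forall₂_congr fun l _ => exists_congr fun m => ?_
      rw [← and_assoc]
      exact and_congr_left fun _ => by omega
    have hsub : s ∈ faceSimplices d N k → s ∈ faceSimplices d N (k + 1) := fun h =>
      mem_faceSimplices.2 ⟨(mem_faceSimplices.1 h).1,
        fun i hi => (mem_faceSimplices.1 h).2 i (by omega)⟩
    simp only [Finset.mem_filter, hiff]
    tauto
  have hsecond : ((faceSimplices d N (k + 1)).filter (IsDoor ℓ k 0)).card =
      (((faceSimplices d N (k + 1)).filter (IsDoor ℓ k (k + 1))).filter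
        (fun s => ¬ s ∈ faceSimplices d N k)).card := by
    refine Finset.card_nbij' (rot ⟨k, hk⟩) (unrot ⟨k, hk⟩) ?_ ?_ ?_ ?_
    · intro s hs
      simp only [Finset.coe_filter, Set.mem_ofPred_eq, Finset.mem_filter] at hs ⊢
      have := rot_mem hℓ (c := ⟨k, hk⟩) hs.1 hs.2
      exact ⟨⟨this.1, this.2.1⟩, this.2.2⟩
    · intro s hs
      simp only [Finset.coe_filter, Set.mem_ofPred_eq, Finset.mem_filter] at hs ⊢
      exact unrot_mem hℓ (c := ⟨k, hk⟩) hs.1.1 hs.1.2 hs.2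
    · exact fun s _ => unrot_rot _ s
    · intro s hs
      simp only [Finset.coe_filter, Set.mem_ofPred_eq, Finset.mem_filter] at hs
      exact rot_unrot _ s (pos_of_not_mem hℓ (c := ⟨k, hk⟩) hs.1.1 hs.1.2 hs.2)
  rw [hfirst, hsecond]
  push_cast
  rw [add_comm, add_assoc, CharTwo.add_self_eq_zero, add_zero]

/-- The number of rainbow simplices is odd: in dimension `0` only the origin counts, with label `0`,
and the parity is preserved from one dimension to the next. -/
theorem exists_rainbow (hℓ : IsLabelling N ℓ) (hN : 0 < N) :
    ∃ s ∈ faceSimplices d N d, IsRainbow ℓ d s := by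
  classical
  have hpar : ∀ k ≤ d,
      (((faceSimplices d N k).filter (IsRainbow ℓ k)).card : ZMod 2) = 1 := by
    intro k hk
    induction k with
    | zero =>
      have : (faceSimplices d N 0).filter (IsRainbow ℓ 0) = {(0, 1)} := by
        ext s
        simp only [Finset.mem_filter, Finset.mem_singleton, mem_faceSimplices]
        constructor
        · rintro ⟨⟨-, h⟩, -⟩
          exact Prod.ext (funext fun i => (h i (Nat.zero_le _)).1)
            (Equiv.ext fun i => (h i (Nat.zero_le _)).2)
        · rintro rfl
          refine ⟨⟨fun i => hN, fun i _ => ⟨rfl, rfl⟩⟩, fun l hl => ⟨0, le_rfl, ?_⟩⟩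
          obtain rfl : l = 0 := by omega
          have hv : vert ((0, 1) : Simplex d) 0 = 0 := by
            funext i
            simp [vert]
          rw [hv]
          rcases Nat.eq_zero_or_pos d with hd | hd
          · have := hℓ.le_dim 0 fun i => Nat.zero_le _
            omega
          · exact Nat.le_zero.1 (hℓ.le_of_eq_zero 0 (fun i => Nat.zero_le _) ⟨0, hd⟩ rfl)
      rw [this]
      simp
    | succ k ih =>
      rw [rainbow_parity_succ hℓ (by omega)]
      exact ih (by omega)
  have hne : ((faceSimplices d N d).filter (IsRainbow ℓ d)).Nonempty := by
    rw [Finset.nonempty_iff_ne_empty]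
    intro h
    have := hpar d le_rfl
    rw [h] at this
    simp at this
  obtain ⟨s, hs⟩ := hne
  exact ⟨s, Finset.mem_filter.1 hs⟩

end Kuhn

/-- Kuhn's cubical form of Sperner's lemma: if opposite faces of a grid are separated by the
predicates `v`, then the values of `v` at the vertices of some cell of Kuhn's triangulation are
pairwise different. -/
theorem exists_injective_of_separates_faces {d N : ℕ} (hN : 0 < N) (v : (Fin d → ℕ) → Fin d → Prop)
    (h0 : ∀ x, (∀ i, x i ≤ N) → ∀ i, x i = 0 → ¬ v x i)
    (h1 : ∀ x, (∀ i, x i ≤ N) → ∀ i, x i = N → v x i) :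
    ∃ (p : Fin d → ℕ) (q : Fin (d + 1) → Fin d → ℕ),
      (∀ k i, p i ≤ q k i ∧ q k i ≤ p i + 1 ∧ q k i ≤ N) ∧ Function.Injective fun k => v (q k) := by
  -- The label is the first index at which `v x` fails, or `d` if there is none. It depends on `v x`
  -- alone, so different labels force different values of `v`.
  let ℓ : (Fin d → ℕ) → ℕ := fun x => sInf ({i | ∃ h : i < d, ¬ v x ⟨i, h⟩} ∪ {d})
  have hℓ : Kuhn.IsLabelling N ℓ :=
    { le_dim := fun x _ => Nat.sInf_le (Or.inr rfl)
      le_of_eq_zero := fun x hx i hi => Nat.sInf_le (Or.inl ⟨i.isLt, h0 x hx i hi⟩)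
      ne_of_eq := by
        intro x hx i hi hℓ
        have hmem : ℓ x ∈ {i | ∃ h : i < d, ¬ v x ⟨i, h⟩} ∪ {d} := Nat.sInf_mem ⟨d, Or.inr rfl⟩
        rw [hℓ] at hmem
        rcases hmem with ⟨h, hv⟩ | h
        · exact hv (h1 x hx i hi)
        · exact absurd h (ne_of_lt i.isLt) }
  obtain ⟨s, hs, hrain⟩ := Kuhn.exists_rainbow hℓ hN
  refine ⟨s.1, fun k => Kuhn.vert s k, fun k i => ⟨?_, ?_, Kuhn.vert_le hs k i⟩, ?_⟩
  · exact Nat.le_add_right _ _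
  · change s.1 i + _ ≤ _
    split_ifs <;> omega
  · let L : Fin (d + 1) → Fin (d + 1) := fun k =>
      ⟨ℓ (Kuhn.vert s k), Nat.lt_succ_of_le (hℓ.le_dim _ (Kuhn.vert_le hs k))⟩
    have hsurj : Function.Surjective L := by
      intro l
      obtain ⟨m, hm, hml⟩ := hrain l (by omega)
      exact ⟨⟨m, by omega⟩, Fin.ext hml⟩
    intro k k' hkk'
    refine (Finite.injective_iff_surjective.2 hsurj) (Fin.ext ?_)
    have hkk' : v (Kuhn.vert s k) = v (Kuhn.vert s k') := hkk'
    simp only [L, ℓ, hkk']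

/-! ### The lower bound from a single cell -/

namespace CoarseStructure

variable {X Y Z : Type*}

theorem coarselyUniform_pi_apply {J : Type*} {F : J → Type*} (E : ∀ j, CoarseStructure (F j))
    (j : J) : CoarselyUniform (CoarseStructure.pi E) (E j) fun x => x j :=
  fun _ hM => hM j

/-- The coarse structure on `X` obtained from `E` by adding the squares of all the sets on which the
function `τ` is bounded. -/
def collapse (E : CoarseStructure X) {R : CoarseStructure ℝ≥0} (hR : R.IsRay) {τ : X → ℝ≥0}
    (hτ : CoarselyUniform E R τ) : CoarseStructure X where
  entourages := {M | ∃ N ∈ E.entourages, ∃ T, ∀ a b, (a, b) ∈ M →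
    (a, b) ∈ N ∨ τ a ≤ T ∧ τ b ≤ T}
  subset_mem := fun ⟨N, hN, T, h⟩ hM => ⟨N, hN, T, fun a b hab => h a b (hM hab)⟩
  union_mem := by
    rintro M M' ⟨N, hN, T, h⟩ ⟨N', hN', T', h'⟩
    refine ⟨N ∪ N', E.union_mem hN hN', max T T', ?_⟩
    rintro a b (hab | hab)
    · exact (h a b hab).imp Or.inl
        (And.imp (fun h => h.trans (le_max_left _ _)) fun h => h.trans (le_max_left _ _))
    · exact (h' a b hab).imp Or.inr
        (And.imp (fun h => h.trans (le_max_right _ _)) fun h => h.trans (le_max_right _ _))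
  diag_mem := ⟨SetRel.id, E.diag_mem, 0, fun _ _ hab => Or.inl hab⟩
  inv_mem := by
    rintro M ⟨N, hN, T, h⟩
    exact ⟨N.inv, E.inv_mem hN, T, fun a b hab => (h b a hab).imp id And.symm⟩
  comp_mem := by
    rintro M M' ⟨N, hN, T, h⟩ ⟨N', hN', T', h'⟩
    -- If one end of a pair in `N` has `τ ≤ T'`, the other end has `τ ≤ s`; so a low pair absorbs an
    -- adjacent pair of `N`.
    obtain ⟨s, hs, hs'⟩ := hR.exists_bound (hτ N hN) T'
    obtain ⟨s', hs1, hs1'⟩ := hR.exists_bound (hτ N' hN') T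
    refine ⟨N.comp N', E.comp_mem hN hN', max (max T T') (max s s'), ?_⟩
    rintro a c ⟨b, hab, hbc⟩
    rcases h a b hab with h1 | ⟨h1, h1'⟩ <;> rcases h' b c hbc with h2 | ⟨h2, h2'⟩
    · exact Or.inl ⟨b, h1, h2⟩
    · exact Or.inr ⟨(hs' _ _ (Or.inl (mk_mem_mapRel τ h1)) h2).trans (by simp),
        h2'.trans (by simp)⟩
    · exact Or.inr ⟨h1.trans (by simp),
        (hs1' _ _ (Or.inr (mk_mem_mapRel τ h2)) h1').trans (by simp)⟩
    · exact Or.inr ⟨h1.trans (by simp), h2'.trans (by simp)⟩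

end CoarseStructure

section Cell

variable {κ : DoubleKind} {R : CoarseStructure ℝ≥0} {n : ℕ}

theorem Cell.height_uniform : CoarselyUniform (cellStructure κ R n) R Prod.snd :=
  coarselyUniform_snd

/-- The coordinates of a point of a cell, after folding. -/
def Cell.coord (a : Cell n) (i : Fin (n + 1)) : ℝ≥0 :=
  Fin.lastCases (motive := fun _ => ℝ≥0) a.2 (fun j => fold (a.1 j)) i

theorem Cell.coord_uniform (hR : R.IsRay) (i : Fin (n + 1)) :
    CoarselyUniform (cellStructure κ R n) R fun a => Cell.coord a i := by
  induction i using Fin.lastCases with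
  | last =>
    simp only [Cell.coord, Fin.lastCases_last]
    exact Cell.height_uniform
  | cast j =>
    simp only [Cell.coord, Fin.lastCases_castSucc]
    exact (coarselyUniform_fold hR).comp
      ((coarselyUniform_pi_apply _ j).comp coarselyUniform_fst)

/-- The point of a cell with given coordinates in the first copies of the ray. -/
def Cell.ofCoord (t : Fin (n + 1) → ℝ≥0) : Cell n :=
  (fun j => Sum.inl (t j.castSucc), t (Fin.last n))

theorem Cell.coord_ofCoord (t : Fin (n + 1) → ℝ≥0) (i : Fin (n + 1)) :
    Cell.coord (Cell.ofCoord t) i = t i := by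
  induction i using Fin.lastCases with
  | last => simp [Cell.coord, Cell.ofCoord]
  | cast j => simp [Cell.coord, Cell.ofCoord, fold]

/-- The pairs of points whose coordinates differ by at most `1`. -/
theorem Cell.ofCoord_mem (hR : R.IsRay) :
    ({p | ∃ s t : Fin (n + 1) → ℝ≥0, (∀ i, s i ≤ t i + 1 ∧ t i ≤ s i + 1) ∧
      p = (Cell.ofCoord s, Cell.ofCoord t)} : SetRel (Cell n) (Cell n)) ∈
      (cellStructure κ R n).entourages := by
  refine ⟨fun j => ?_, ?_⟩
  · refine (doubleRay κ R).subset_mem (coarselyUniform_doubleRay_inl _ (hR.metric_mem 1)) ?_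
    refine mapRel_subset fun x y hxy => ?_
    obtain ⟨a, b, ⟨s, t, hst, h⟩, rfl, rfl⟩ := mem_mapRel.1 hxy
    obtain ⟨rfl, rfl⟩ := Prod.mk.inj h
    exact mk_mem_mapRel Sum.inl (hst j.castSucc)
  · refine R.subset_mem (hR.metric_mem 1) ?_
    refine mapRel_subset ?_
    rintro _ _ ⟨s, t, hst, h⟩
    obtain ⟨rfl, rfl⟩ := Prod.mk.inj h
    exact hst (Fin.last n)

/-- The map that collapses the boundary sphere of a cell to a point. -/
noncomputable def Cell.crush (a : Cell n) : Cell n :=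
  open Classical in if a.2 = 0 then (fun _ => Sum.inl 0, 0) else a

theorem Cell.crush_of_ne {a : Cell n} (h : a.2 ≠ 0) : a.crush = a := if_neg h

theorem Cell.crush_snd (a : Cell n) : a.crush.2 = a.2 := by
  unfold Cell.crush
  split_ifs with h
  · exact h.symm
  · rfl

/-- Related points of which exactly one has height `0` are torn apart, but both then have height at
most `s`, and the collapsed structure does not distinguish points there. -/
theorem Cell.crush_uniform (hR : R.IsRay) : CoarselyUniform (cellStructure κ R n)
    ((cellStructure κ R n).collapse hR Cell.height_uniform) Cell.crush := by
  intro M hM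
  obtain ⟨s, -, hs⟩ := hR.exists_bound (Cell.height_uniform M hM) 0
  refine ⟨M, hM, s, fun a b hab => ?_⟩
  obtain ⟨x, y, hxy, rfl, rfl⟩ := mem_mapRel.1 hab
  have hmem := mk_mem_mapRel Prod.snd hxy
  simp only [Cell.crush_snd]
  by_cases hx : x.2 = 0
  · exact Or.inr ⟨hx ▸ zero_le, hs _ _ (Or.inr hmem) hx.le⟩
  · by_cases hy : y.2 = 0
    · exact Or.inr ⟨hs _ _ (Or.inl hmem) hy.le, hy ▸ zero_le⟩
    · left
      rwa [Cell.crush_of_ne hx, Cell.crush_of_ne hy]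

end Cell

/-- A coarse space has asymptotic dimension at least `m + 1` if it contains the interior of a coarse
cell of dimension `m` as a retract up to the collapse of the boundary. -/
theorem AsdimLE.le_of_cell {Y : Type*} {E : CoarseStructure Y} {κ : DoubleKind}
    {R : CoarseStructure ℝ≥0} (hR : R.IsRay) {m n : ℕ} (hE : E.AsdimLE n) {χ : Cell m → Y}
    (hχ : CoarselyUniform (cellStructure κ R m) E χ) {q : Y → Cell m}
    (hq : CoarselyUniform E ((cellStructure κ R m).collapse hR Cell.height_uniform) q)
    (hqχ : ∀ a : Cell m, a.2 ≠ 0 → q (χ a) = a) : m + 1 ≤ n := by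
  classical
  obtain ⟨U, -, hmult, happ, hbdd⟩ := hE _ (hχ _ (Cell.ofCoord_mem hR))
  obtain ⟨K, hK, T, hT⟩ := hq _ hbdd
  have hbound : ∀ i : Fin (m + 1), ∃ s, ∀ a b : Cell m, (a, b) ∈ K → b.coord i ≤ T + 1 →
      a.coord i ≤ s := by
    intro i
    obtain ⟨s, -, hs⟩ := hR.exists_bound (Cell.coord_uniform hR i K hK) (T + 1)
    exact ⟨s, fun a b hab hb =>
      hs _ _ (Or.inl (mk_mem_mapRel (fun a : Cell m => a.coord i) hab)) hb⟩
  choose s hs using hbound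
  -- Exceeding the sum, `N` exceeds every `s i`, so no member of the cover reaches from the face `x
  -- i = 0` to the face `x i = N`.
  obtain ⟨N, hN⟩ := exists_nat_gt (∑ i, s i)
  have hN0 : 0 < N := by
    rcases Nat.eq_zero_or_pos N with h | h
    · subst h
      simp at hN
    · exact h
  -- The grid starts at `T + 1`, above the region where the collapsed structure gives no control. It
  -- depends on the cover, which is already fixed.
  let pt : (Fin (m + 1) → ℕ) → Cell m := fun x => Cell.ofCoord fun i => T + 1 + x i
  have hpt : ∀ x, (pt x).2 ≠ 0 := fun x => by
    change T + 1 + (x (Fin.last m) : ℝ≥0) ≠ 0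
    positivity
  have hTpt : ∀ x, ¬ (pt x).2 ≤ T := fun x => by
    change ¬ T + 1 + (x (Fin.last m) : ℝ≥0) ≤ T
    rw [not_le, add_assoc]
    exact lt_add_of_pos_right T (by positivity)
  have hcoord : ∀ x i, (pt x).coord i = T + 1 + x i := fun x i => Cell.coord_ofCoord _ i
  have hnear : ∀ x y : Fin (m + 1) → ℕ, (∀ i, x i ≤ y i ∧ y i ≤ x i + 1) →
      χ (pt x) ∈ slice (mapRel χ {p | ∃ s t : Fin (m + 1) → ℝ≥0,
        (∀ i, s i ≤ t i + 1 ∧ t i ≤ s i + 1) ∧ p = (Cell.ofCoord s, Cell.ofCoord t)})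
        (χ (pt y)) := by
    intro x y hxy
    refine mk_mem_mapRel χ ⟨_, _, fun i => ?_, rfl⟩
    have h1 : (x i : ℝ≥0) ≤ y i := by exact_mod_cast (hxy i).1
    have h2 : (y i : ℝ≥0) ≤ x i + 1 := by exact_mod_cast (hxy i).2
    constructor
    · exact (add_le_add le_rfl h1).trans le_self_add
    · rw [add_assoc (T + 1)]
      exact add_le_add le_rfl h2
  choose V hVU hV using fun x => happ (χ (pt x))
  have hself : ∀ x, χ (pt x) ∈ V x := fun x => hV x (hnear x x fun i => ⟨le_rfl, Nat.le_succ _⟩)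
  have hsep : ∀ x y z i, χ (pt x) ∈ V z → χ (pt y) ∈ V z → y i = 0 → x i ≠ N := by
    intro x y z i hx hy hyi hxi
    have hmem : (χ (pt x), χ (pt y)) ∈ ⋃ W ∈ U, W ×ˢ W :=
      Set.mem_biUnion (hVU z) (Set.mk_mem_prod hx hy)
    have hxy := hT _ _ (mk_mem_mapRel q hmem)
    rw [hqχ _ (hpt x), hqχ _ (hpt y)] at hxy
    rcases hxy with hxy | ⟨h, -⟩
    · have h1 := hs i _ _ hxy (by simp [hcoord, hyi])
      rw [hcoord, hxi] at h1
      have h2 : (N : ℝ≥0) ≤ s i := le_add_self.trans h1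
      have h3 : s i ≤ ∑ i, s i := Finset.single_le_sum (fun _ _ => zero_le) (Finset.mem_univ i)
      exact absurd (h2.trans h3) (not_le.2 hN)
    · exact hTpt x h
  -- The predicate says that the member chosen at `x` misses the face `y i = 0`. It fails on that
  -- face, because the member at `x` contains `x`, and holds on the opposite one by `hsep`. Where
  -- its values differ, the members differ.
  obtain ⟨p, Q, hQ, hinj⟩ := exists_injective_of_separates_faces hN0
    (fun x i => ∀ y : Fin (m + 1) → ℕ, y i = 0 → χ (pt y) ∉ V x)
    (fun x _ i hi h => h x hi (hself x))
    (fun x _ i hi y hy hyV => hsep x y x i (hself x) hyV hy hi)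
  have hVinj : Function.Injective fun k => V (Q k) := by
    intro k k' h
    refine hinj ?_
    have h : V (Q k) = V (Q k') := h
    simp only [h]
  have hcard : ((m + 1 + 1 : ℕ) : ℕ∞) ≤ ((n + 1 : ℕ) : ℕ∞) := by
    calc ((m + 1 + 1 : ℕ) : ℕ∞) = (Set.range fun k => V (Q k)).encard := by
          rw [← Set.image_univ, hVinj.encard_image]
          simp
      _ ≤ {W ∈ U | χ (pt p) ∈ W}.encard := by
          refine Set.encard_le_encard ?_
          rintro _ ⟨k, rfl⟩
          -- Every vertex of the cell is within a unit step of the corner `p`, so by appetite all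
          -- the chosen members contain it.
          exact ⟨hVU _, hV _ (hnear p (Q k) fun i => ⟨(hQ k i).1, (hQ k i).2.1⟩)⟩
      _ ≤ ((n + 1 : ℕ) : ℕ∞) := by
          push_cast
          exact hmult _
  have := Nat.cast_le.1 hcard
  omega

/-! ### Crushing a complex to one of its cells -/

namespace CoarseCellComplex

variable {κ : DoubleKind} (C : CoarseCellComplex.{u, v} κ)

open Classical in
/-- The map from the disjoint union of the cells of a stage to the cell with index `i` that
collapses the boundary of this cell and all the other cells to a point. -/
noncomputable def crush (k : ℕ) (i : C.I k) (x : Σ j : C.I k, Cell (C.n k j)) : Cell (C.n k i) :=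
  if h : x.1 = i then Cell.crush (h ▸ x.2) else (fun _ => Sum.inl 0, 0)

theorem crush_mk (k : ℕ) (i : C.I k) (a : Cell (C.n k i)) : C.crush k i ⟨i, a⟩ = a.crush := by
  simp [crush]

theorem crush_of_flatten (k : ℕ) (i : C.I k) (x : Σ j : C.I k, Cell (C.n k j)) (hx : x.2.2 = 0) :
    C.crush k i x = (fun _ => Sum.inl 0, 0) := by
  obtain ⟨j, a⟩ := x
  by_cases h : j = i
  · subst h
    rw [crush_mk]
    exact if_pos hx
  · simp [crush, h]

theorem crush_uniform (k : ℕ) (i : C.I k) : CoarselyUniform (C.cells k)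
    ((cellStructure κ (C.R k i) (C.n k i)).collapse (C.isRay k i) Cell.height_uniform)
    (C.crush k i) := by
  refine coarselyUniform_from_coprod fun j => ?_
  by_cases h : j = i
  · subst h
    convert Cell.crush_uniform (κ := κ) (n := C.n k j) (C.isRay k j) using 1
    funext a
    exact C.crush_mk k j a
  · convert CoarselyUniform.const (E := cellStructure κ (C.R k j) (C.n k j))
      (F := (cellStructure κ (C.R k i) (C.n k i)).collapse (C.isRay k i) Cell.height_uniform)
      ((fun _ => Sum.inl 0, 0) : Cell (C.n k i)) using 1
    funext a
    simp [crush, h]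

/-- Here `χ` is the characteristic map, and `q` sends the sphere and everything outside the cell to
one point. This respects the gluing, and for attached cells uniformity follows from the minimality
of the attached structure. -/
theorem exists_stage_retract (k : ℕ) (i : C.I k) :
    ∃ (χ : Cell (C.n k i) → C.Y k) (q : C.Y k → Cell (C.n k i)),
      CoarselyUniform (cellStructure κ (C.R k i) (C.n k i)) (C.E k) χ ∧
      CoarselyUniform (C.E k) ((cellStructure κ (C.R k i) (C.n k i)).collapse (C.isRay k i)
        Cell.height_uniform) q ∧ ∀ a, a.2 ≠ 0 → q (χ a) = a := by
  cases k with
  | zero =>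
    refine ⟨fun a => C.zeroEquiv.symm ⟨i, a⟩, fun y => C.crush 0 i (C.zeroEquiv y), ?_, ?_, ?_⟩
    · intro M hM
      rw [C.zero_structure, mem_comap, mapRel_mapRel]
      convert coarselyUniform_sigmaMk (fun i => cellStructure κ (C.R 0 i) (C.n 0 i)) i M hM using 2
      funext a
      exact C.zeroEquiv.apply_symm_apply _
    · rw [C.zero_structure]
      exact (C.crush_uniform 0 i).comp (CoarselyUniform.comap _ _)
    · intro a ha
      change C.crush 0 i (C.zeroEquiv (C.zeroEquiv.symm ⟨i, a⟩)) = a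
      rw [Equiv.apply_symm_apply, crush_mk, Cell.crush_of_ne ha]
  | succ k =>
    have H := C.isRetractAttachment k
    let q' : Attach (jointMap (C.f k)) → Cell (C.n (k + 1) i) :=
      Quot.lift (Sum.elim (C.crush (k + 1) i) fun _ => (fun _ => Sum.inl 0, 0)) (by
        rintro _ _ ⟨⟨x, hx⟩⟩
        exact C.crush_of_flatten (k + 1) i x hx)
    let q : C.Y (k + 1) → Cell (C.n (k + 1) i) := fun y => q' (C.succEquiv k y)
    have hqp : ∀ x, q (C.cellMap k x) = C.crush (k + 1) i x := fun x =>
      congrArg q' (Equiv.apply_symm_apply (C.succEquiv k) (Quot.mk _ (Sum.inl x)))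
    have hqi : ∀ z, q (C.incl k z) = (fun _ => Sum.inl 0, 0) := fun z =>
      congrArg q' (Equiv.apply_symm_apply (C.succEquiv k) (Quot.mk _ (Sum.inr z)))
    refine ⟨fun a => C.cellMap k ⟨i, a⟩, q,
      H.p_uniform.comp (coarselyUniform_sigmaMk
        (fun i => cellStructure κ (C.R (k + 1) i) (C.n (k + 1) i)) i), ?_, ?_⟩
    · refine H.minimal (CoarseStructure.comap q ((cellStructure κ (C.R (k + 1) i)
        (C.n (k + 1) i)).collapse (C.isRay (k + 1) i) Cell.height_uniform))
        (fun M hM => ?_) (fun M hM => ?_) <;>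
        rw [mem_comap, mapRel_mapRel]
      · rw [show q ∘ C.cellMap k = C.crush (k + 1) i from funext hqp]
        exact C.crush_uniform (k + 1) i M hM
      · rw [show q ∘ C.incl k = fun _ => (fun _ => Sum.inl 0, 0) from funext hqi]
        exact CoarselyUniform.const _ M hM
    · intro a ha
      rw [hqp, crush_mk, Cell.crush_of_ne ha]

theorem le_of_asdimLE {N : ℕ} (h : C.coarseStructure.AsdimLE N) (k : ℕ) (i : C.I k) :
    C.n k i + 1 ≤ N := by
  obtain ⟨χ, q, hχ, hq, hqχ⟩ := C.exists_stage_retract k i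
  refine AsdimLE.le_of_cell (C.isRay k i) h ((C.toSpace_uniform k).comp hχ)
    (hq.comp (C.spaceRetract_uniform k)) fun a ha => ?_
  rw [Function.comp_apply, Function.comp_apply, C.spaceRetract_toSpace, hqχ a ha]

theorem exists_cell (hC : Nonempty C.Space) : ∃ k, Nonempty (C.I k) := by
  have hstage : ∀ k, Nonempty (C.Y k) → ∃ k, Nonempty (C.I k) := by
    intro k
    induction k with
    | zero => exact fun ⟨y⟩ => ⟨0, ⟨(C.zeroEquiv y).1⟩⟩
    | succ k ih =>
      rintro ⟨y⟩
      rcases (C.isRetractAttachment k).cover y with ⟨x, -⟩ | ⟨z, -⟩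
      exacts [⟨k + 1, ⟨x.1⟩⟩, ih ⟨z⟩]
  obtain ⟨w⟩ := hC
  obtain ⟨⟨k, y⟩, -⟩ := Quot.exists_rep w
  exact hstage k ⟨y⟩

end CoarseCellComplex

/-! ### The dimension formula -/

theorem mainTheorem6 (κ : DoubleKind) (C : CoarseCellComplex.{u, v} κ) (hC : Nonempty C.Space) :
    C.coarseStructure.asdim = C.cellDim + 1 := by
  refine le_antisymm ?_ ?_
  · rcases eq_or_ne C.cellDim ⊤ with h | h
    · rw [h]
      exact le_top
    · obtain ⟨N, hN⟩ := ENat.ne_top_iff_exists.1 h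
      have hle : ∀ k i, C.n k i ≤ N := fun k i => by
        have h1 : (C.n k i : ℕ∞) ≤ C.cellDim := le_iSup₂_of_le k i le_rfl
        rw [← hN] at h1
        exact Nat.cast_le.1 h1
      rw [← hN]
      exact iInf₂_le_of_le (N + 1) (C.coloredLE hle).asdimLE (by push_cast; exact le_rfl)
  · refine le_iInf₂ fun N hN => ?_
    -- A cell is needed to get `1 ≤ N`: over an empty family the supremum would be `0` and the bound
    -- `cellDim + 1 ≤ N` would fail for `N = 0`.
    obtain ⟨k, ⟨i⟩⟩ := C.exists_cell hC
    have h1 := C.le_of_asdimLE hN k i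
    obtain ⟨N, rfl⟩ : ∃ M, N = M + 1 := ⟨N - 1, by omega⟩
    have h2 : C.cellDim ≤ N := iSup₂_le fun k i => by
      have := C.le_of_asdimLE hN k i
      exact Nat.cast_le.2 (by omega)
    push_cast
    exact add_le_add h2 le_rfl
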